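/- Let $(X_i)_{i\ge1}$ and $(C_i)_{i\ge1}$ be two independent sequences of i.i.d. non-negative random variables with continuous distribution functions $F$ and $G$. Put $Z_i=\min(X_i,C_i)$ and $\delta_i=\mathbf 1_{X_i\le C_i}$, let $H$ be the distribution function of $Z_1$ (so $1-H=(1-F)(1-G)$), let $Z_{1,n}\le\dots\le Z_{n,n}$ be the order statistics of $Z_1,\dots,Z_n$, and let $\delta_{1,n},\dots,\delta_{n,n}$ be the $\delta$'s that correspond to them. For $t<Z_{n,n}$ let $$1-\hat F_n(t)=\prod_{Z_{i,n}\le t}\Big(\frac{n-i}{n-i+1}\Big)^{\delta_{i,n}},\qquad 1-\hat G_n(t)=\prod_{Z_{i,n}\le t}\Big(\frac{n-i}{n-i+1}\Big)^{1-\delta_{i,n}}$$ be the Kaplan--Meier estimators, and write $\hat G_n(z^-)$ for the left limit of $\hat G_n$ at $z$. For $\alpha\ge1$ and $1\le k<n$ put $L_{j}=\log^{\alpha}(Z_{j,n}/Z_{n-k,n})$ and $$M^{(\alpha)}_{n,k}=\frac1{n(1-\hat F_n(Z_{n-k,n}))}\sum_{i=1}^{k}\frac{\delta_{n-i+1,n}}{1-\hat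 G_n(Z^-_{n-i+1,n})}\,L_{n-i+1},$$ $$\widetilde M^{(\alpha)}_{n,k}=\frac1{n(1-\hat F_n(Z_{n-k,n}))}\sum_{i=1}^{k}\frac{i\,(L_{n-i+1}-L_{n-i})}{1-\hat G_n(Z^-_{n-i+1,n})},$$ $$D^{(\alpha)}_{n,k}=\frac{1}{n(1-\hat F_n(Z_{n-k,n}))(1-\hat G_n(Z^-_{n,n}))}\log^{\alpha}\Big(\frac{Z_{n,n}}{Z_{n-k,n}}\Big).$$ (i) Almost surely the $Z_i$ are pairwise distinct; and whenever $Z_1,\dots,Z_n$ are pairwise distinct, then for all $\alpha\ge1$ and $1\le k<n$, $$\widetilde M^{(\alpha)}_{n,k}=M^{(\alpha)}_{n,k}+(1-\delta_{n,n})\,D^{(\alpha)}_{n,k}.$$ (ii) For $\gamma\ne0$ let $H_\gamma(x)=\exp(-(1+\gamma x)^{-1/\gamma})$ if $1+\gamma x>0$; if $1+\gamma x\le0$ let $H_\gamma(x)=1$ for $\gamma<0$ and $H_\gamma(x)=0$ for $\gamma>0$. Write $F\in D(H_\gamma)$ if $F^n(a_nx+b_n)\to H_\gamma(x)$ for all $x\in\mathbb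 R$, for some $a_n>0$ and $b_n\in\mathbb R$. Suppose that $F\in D(H_{\gamma_X})$ and $G\in D(H_{\gamma_C})$ with $\gamma_X<0$, $\gamma_C<0$, and that $F$ and $G$ have the same right endpoint $\sup\{x:F(x)<1\}=\sup\{x:G(x)<1\}$. Put $\gamma=\gamma_X\gamma_C/(\gamma_X+\gamma_C)$ and $U(t)=\inf\{x:H(x)\ge1-1/t\}$ for $t>1$, and let $a$ be any positive function with $$\lim_{t\to\infty}\frac{\log U(tx)-\log U(t)}{a(t)/U(t)}=\frac{x^\gamma-1}{\gamma}\qquad\text{for all }x>0.$$ Let $(k_n)$ be integers with $k_n\to\infty$ and $k_n=o(n)$ such that $-\log(k_n/n)/k_n=O(n^{-\delta})$ for some $\delta>0$ if $\gamma_C<\gamma_X$, and for some $\delta\ge(\gamma_X-\gamma_C)/(\gamma_X+\gamma_C)$ if $\gamma_C\ge\gamma_X$. Put $a_{n,k}=a(n/k_n)/U(n/k_n)$. Then for every $\alpha\ge1$, $D^{(\alpha)}_{n,k_n}=o_{\mathbb P}(a_{n,k}^{\alpha})$, that is, $D^{(\alpha)}_{n,k_n}/a_{n,k}^{\alpha}\to0$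 in probability; consequently $\widetilde M^{(\alpha)}_{n,k_n}-M^{(\alpha)}_{n,k_n}=o_{\mathbb P}(a_{n,k}^{\alpha})$ as well. -/

import Mathlib

open MeasureTheory ProbabilityTheory Filter Topology Asymptotics

noncomputable section

namespace CensoredEVT

/-! ### Maximum domains of attraction -/

/-- The extreme value distribution function `H_γ` on the whole real line. Off the set
`1 + γ x > 0` it is `0` (below the left endpoint, `γ > 0`) or `1` (above the right endpoint,
`γ < 0`). -/
def gev (γ x : ℝ) : ℝ :=
  if γ = 0 then Real.exp (-Real.exp (-x))
  else if 0 < 1 + γ * x then Real.exp (-(1 + γ * x) ^ (-(1 / γ)))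
  else if 0 < γ then 0 else 1

/-- `F ∈ D(H_γ)`. -/
def InDomainOfAttraction (F : ℝ → ℝ) (γ : ℝ) : Prop :=
  ∃ a b : ℕ → ℝ, (∀ n, 0 < a n) ∧
    ∀ x : ℝ, Tendsto (fun n : ℕ => F (a n * x + b n) ^ n) atTop (𝓝 (gev γ x))

/-- The right endpoint `τ_F = sup {x | F x < 1}`, as an extended real. -/
def rightEndpoint (F : ℝ → ℝ) : EReal :=
  sSup ((fun x : ℝ => (x : EReal)) '' {x : ℝ | F x < 1})

/-- The tail quantile function `U t = H^←(1 - 1/t)`, `t > 1`, where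
`H^←(y) = inf {x | y ≤ H x}` is the left-continuous inverse. -/
def tailQuantile (H : ℝ → ℝ) (t : ℝ) : ℝ :=
  sInf {x : ℝ | 1 - 1 / t ≤ H x}

/-- `a` is a positive function with
`(log U(tx) - log U(t)) / (a(t) / U(t)) → (x^γ - 1) / γ` as `t → ∞`, for every `x > 0`. -/
def IsLogAuxiliary (U : ℝ → ℝ) (γ : ℝ) (a : ℝ → ℝ) : Prop :=
  (∀ t : ℝ, 1 < t → 0 < a t) ∧
    ∀ x : ℝ, 0 < x →
      Tendsto (fun t : ℝ => (Real.log (U (t * x)) - Real.log (U t)) / (a t / U t)) atTop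
        (𝓝 ((x ^ γ - 1) / γ))

/-- The growth condition on `(k_n)`: `-log(k_n/n)/k_n = O(n^{-δ})` for some `δ > 0` when
`γ_C < γ_X`, and for some `δ ≥ (γ_X - γ_C)/(γ_X + γ_C)` when `γ_C ≥ γ_X`. -/
def GrowthCondition (γX γC : ℝ) (k : ℕ → ℕ) : Prop :=
  ∃ δ : ℝ, (γC < γX → 0 < δ) ∧ (γX ≤ γC → (γX - γC) / (γX + γC) ≤ δ) ∧
    (fun n : ℕ => -Real.log ((k n : ℝ) / (n : ℝ)) / (k n : ℝ)) =O[atTop]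
      (fun n : ℕ => (n : ℝ) ^ (-δ))

/-! ### Randomly right-censored samples

The data are sequences `x` (lifetimes) and `c` (censoring times); the sample of size `n` consists
of their first `n` terms, with indices `0, …, n - 1`. Ranks run from `1` to `n`. -/

/-- The observation `Z_j = X_j ∧ C_j`. -/
def obs (x c : ℕ → ℝ) (j : ℕ) : ℝ := min (x j) (c j)

/-- The indicator `δ_j = 1_{X_j ≤ C_j}`. -/
def unc (x c : ℕ → ℝ) (j : ℕ) : ℕ := if x j ≤ c j then 1 else 0

/-- The index of the observation of rank `i` (`1 ≤ i ≤ n`, ascending order) among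
`z 0, …, z (n - 1)`; ties are broken by the index. -/
def rankIndex (n : ℕ) (z : ℕ → ℝ) (i : ℕ) : ℕ :=
  if h : i - 1 < n then (Tuple.sort (fun j : Fin n => z j) ⟨i - 1, h⟩ : ℕ) else 0

/-- The order statistic `Z_{i,n}`. -/
def obsOrd (x c : ℕ → ℝ) (n i : ℕ) : ℝ := obs x c (rankIndex n (obs x c) i)

/-- The indicator `δ_{i,n}` that goes with `Z_{i,n}`. -/
def uncOrd (x c : ℕ → ℝ) (n i : ℕ) : ℕ := unc x c (rankIndex n (obs x c) i)

/-- The Kaplan-Meier estimator `F̂_n` of the distribution function of the lifetimes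
(only its values at `t < Z_{n,n}` are ever used). -/
def kmF (x c : ℕ → ℝ) (n : ℕ) (t : ℝ) : ℝ :=
  1 - ∏ i ∈ (Finset.Icc 1 n).filter (fun i => obsOrd x c n i ≤ t),
    (((n : ℝ) - i) / ((n : ℝ) - i + 1)) ^ uncOrd x c n i

/-- The Kaplan-Meier estimator `Ĝ_n` of the distribution function of the censoring times
(only its values at `t < Z_{n,n}` are ever used). -/
def kmG (x c : ℕ → ℝ) (n : ℕ) (t : ℝ) : ℝ :=
  1 - ∏ i ∈ (Finset.Icc 1 n).filter (fun i => obsOrd x c n i ≤ t),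
    (((n : ℝ) - i) / ((n : ℝ) - i + 1)) ^ (1 - uncOrd x c n i)

/-- `log^α (Z_{j,n} / Z_{n-k,n})`. -/
def logExcess (α : ℝ) (x c : ℕ → ℝ) (n k j : ℕ) : ℝ :=
  Real.log (obsOrd x c n j / obsOrd x c n (n - k)) ^ α

/-- The Kaplan-Meier weighted moment `M^{(α)}_{n,k}`. -/
def momentKM (α : ℝ) (x c : ℕ → ℝ) (n k : ℕ) : ℝ :=
  1 / ((n : ℝ) * (1 - kmF x c n (obsOrd x c n (n - k)))) *
    ∑ i ∈ Finset.Icc 1 k,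
      (uncOrd x c n (n - i + 1) : ℝ) /
          (1 - Function.leftLim (kmG x c n) (obsOrd x c n (n - i + 1))) *
        logExcess α x c n k (n - i + 1)

/-- The weighted spacing `ξ_{i,n}`. -/
def xi (α : ℝ) (x c : ℕ → ℝ) (n k i : ℕ) : ℝ :=
  (i : ℝ) * (logExcess α x c n k (n - i + 1) - logExcess α x c n k (n - i))

/-- The Leurgans-type weighted moment `M̃^{(α)}_{n,k}`. -/
def momentL (α : ℝ) (x c : ℕ → ℝ) (n k : ℕ) : ℝ :=
  1 / ((n : ℝ) * (1 - kmF x c n (obsOrd x c n (n - k)))) *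
    ∑ i ∈ Finset.Icc 1 k,
      1 / (1 - Function.leftLim (kmG x c n) (obsOrd x c n (n - i + 1))) * xi α x c n k i

/-- The term `D^{(α)}_{n,k}` of the maximum observation. -/
def maxTerm (α : ℝ) (x c : ℕ → ℝ) (n k : ℕ) : ℝ :=
  1 / ((n : ℝ) * (1 - kmF x c n (obsOrd x c n (n - k))) *
      (1 - Function.leftLim (kmG x c n) (obsOrd x c n n))) *
    logExcess α x c n k n

end CensoredEVT

end

noncomputable section

namespace CensoredEVT

/-! ### Sequences with geometrically decaying increments -/

/-! Part (i) is an Abel summation. Write `w i` for the reciprocal of `1 - Ĝ` just before the `i`-th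
largest observation and `d i` for its indicator. One factor of the product limit separates `w i`
from `w (i + 1)`, and since `d` is 0 or 1 this reads `i w i = (i + 1 - d (i + 1)) w (i + 1)`. Hence
the coefficients of the spacings collapse to `d i * w i`, with a defect `1 - d 1` only at the
maximum (`sum_weights_by_parts`, `momentL_eq`). Absence of ties is almost sure because independent
atomless variables almost surely differ.

For part (ii), each factor `(n-i)/(n-i+1)` splits into its `F̂` and `Ĝ` powers, and all factors
below rank `n` multiply to `1/n`. So the maximum term is exactly the product of the `F̂` factors
over the ranks in `(n-k, n-1]` times the log excess of the maximum (`maxTerm_eq`). With probability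
tending to one the log excess is at most `log τ - log U(n/(4k))`, which is `O(a_{n,k})`, since
increments of `log U` along doublings decay like a geometric series when `γ < 0`
(`log_endpoint_sub_le`). It remains to see that the product tends to 0 in probability, and it is at
most `exp(1 - S)` with `S = ∑ δ_{i,n}/(n-i+1)` over the top `k` ranks.

To show that `S` is large, cut a left neighbourhood of the endpoint `τ` at levels `s_m = τ - ζ^m (τ
- s_0)`. Regular variation at `τ` (`tail_le_and_ge_of_inDomainOfAttraction`) makes the tail of `F`
at least halve at each step, while the tail of `G` keeps a fixed fraction `cG`. A block therefore
holds a fixed proportion of uncensored points among the observations above its lower end, and by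
Chebyshev it adds at least `cG/6` to `S` with probability tending to one. The number `M` of blocks
is arbitrary but fixed, so the product can be made as small as desired (`abs_maxTerm_le`,
`tendsto_measure_maxTerm_gt`). -/

theorem sub_le_of_geometric {u h : ℕ → ℝ} {A ρ : ℝ} (hA : 0 ≤ A) (hρ0 : 0 ≤ ρ) (hρ : ρ < 1)
    (h0 : 0 ≤ h 0) (hu : ∀ m, u (m + 1) - u m ≤ A * h m) (hh : ∀ m, h (m + 1) ≤ ρ * h m)
    (m : ℕ) : u m - u 0 ≤ A * h 0 / (1 - ρ) := by
  have hgeo : ∀ m, h m ≤ ρ ^ m * h 0 := by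
    intro m
    induction m with
    | zero => simp
    | succ m ih =>
      calc h (m + 1) ≤ ρ * h m := hh m
        _ ≤ ρ * (ρ ^ m * h 0) := by gcongr
        _ = ρ ^ (m + 1) * h 0 := by ring
  -- The bound is sharpened to the partial geometric sum so that the induction closes.
  have key : ∀ m, u m - u 0 ≤ A * h 0 / (1 - ρ) * (1 - ρ ^ m) := by
    intro m
    induction m with
    | zero => simp
    | succ m ih =>
      have h1 : u (m + 1) - u m ≤ A * (ρ ^ m * h 0) :=
        (hu m).trans (mul_le_mul_of_nonneg_left (hgeo m) hA)
      have h2 : A * h 0 / (1 - ρ) * (1 - ρ ^ (m + 1)) =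
          A * h 0 / (1 - ρ) * (1 - ρ ^ m) + A * (ρ ^ m * h 0) := by
        have : 1 - ρ ≠ 0 := by linarith
        field_simp
        ring
      linarith
  have h3 : 0 ≤ A * h 0 / (1 - ρ) := div_nonneg (mul_nonneg hA h0) (by linarith)
  have h4 : 0 ≤ ρ ^ m := pow_nonneg hρ0 m
  nlinarith [key m]

/-! ### The negative domain of attraction -/

/-- `-log H_γ` for `γ < 0`. -/
def gevTail (γ x : ℝ) : ℝ := (max 0 (1 + γ * x)) ^ (-(1 / γ))

variable {γ : ℝ}

theorem gev_eq_exp_neg_gevTail (hγ : γ < 0) (x : ℝ) : gev γ x = Real.exp (-gevTail γ x) := by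
  have hp : 0 < -(1 / γ) := by
    have := one_div_neg.mpr hγ
    linarith
  unfold gev gevTail
  rw [if_neg hγ.ne, if_neg hγ.not_gt]
  split_ifs with h
  · rw [max_eq_right h.le]
  · rw [max_eq_left (not_lt.mp h), Real.zero_rpow hp.ne']
    simp

theorem continuous_gevTail (hγ : γ < 0) : Continuous (gevTail γ) := by
  have hp : 0 ≤ -(1 / γ) := by
    have := one_div_neg.mpr hγ
    linarith
  unfold gevTail
  exact (continuous_const.max (by fun_prop)).rpow_const fun _ => Or.inr hp

theorem gevTail_nonneg (x : ℝ) : 0 ≤ gevTail γ x := Real.rpow_nonneg (le_max_left _ _) _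

theorem gevTail_lt (hγ : γ < 0) {x y : ℝ} (hxy : x < y) (hx : 0 < 1 + γ * x) :
    gevTail γ y < gevTail γ x := by
  have hp : 0 < -(1 / γ) := by
    have := one_div_neg.mpr hγ
    linarith
  refine Real.rpow_lt_rpow (le_max_left _ _) ?_ hp
  rw [max_eq_right hx.le]
  exact max_lt hx (by nlinarith)

theorem gevTail_endpoint_sub (hγ : γ < 0) {z : ℝ} (hz : 0 ≤ z) :
    gevTail γ (-(1 / γ) - z) = (-γ * z) ^ (-(1 / γ)) := by
  have : 1 + γ * (-(1 / γ) - z) = -γ * z := by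
    field_simp [hγ.ne]
    ring
  rw [gevTail, this, max_eq_right (by nlinarith)]

/-- `F^n (a_n x_n + b_n) → H_γ x` whenever `x_n → x`. -/
theorem tendsto_pow_of_tendsto (hγ : γ < 0) {F : ℝ → ℝ} (hFmono : Monotone F)
    (hF0 : ∀ x, 0 ≤ F x) {a b : ℕ → ℝ} (ha : ∀ n, 0 < a n)
    (hlim : ∀ x : ℝ, Tendsto (fun n : ℕ => F (a n * x + b n) ^ n) atTop (𝓝 (gev γ x)))
    {u : ℕ → ℝ} {x : ℝ} (hu : Tendsto u atTop (𝓝 x)) :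
    Tendsto (fun n : ℕ => F (a n * u n + b n) ^ n) atTop (𝓝 (Real.exp (-gevTail γ x))) := by
  have hcont : Continuous (fun x => Real.exp (-gevTail γ x)) :=
    Real.continuous_exp.comp (continuous_gevTail hγ).neg
  rw [tendsto_order]
  constructor
  · intro q hq
    have h1 : ∀ᶠ y in 𝓝 x, q < Real.exp (-gevTail γ y) :=
      hcont.continuousAt.eventually (lt_mem_nhds hq)
    obtain ⟨y, hyx, hy⟩ := ((frequently_lt_nhds x).and_eventually h1).exists
    have h2 := hlim y
    rw [gev_eq_exp_neg_gevTail hγ] at h2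
    filter_upwards [h2.eventually (lt_mem_nhds hy), hu.eventually (lt_mem_nhds hyx)] with n hn hn'
    refine hn.trans_le (pow_le_pow_left₀ (hF0 _) (hFmono ?_) n)
    nlinarith [ha n]
  · intro q hq
    have h1 : ∀ᶠ y in 𝓝 x, Real.exp (-gevTail γ y) < q :=
      hcont.continuousAt.eventually (gt_mem_nhds hq)
    obtain ⟨y, hyx, hy⟩ := ((frequently_gt_nhds x).and_eventually h1).exists
    have h2 := hlim y
    rw [gev_eq_exp_neg_gevTail hγ] at h2
    filter_upwards [h2.eventually (gt_mem_nhds hy), hu.eventually (gt_mem_nhds hyx)] with n hn hn'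
    refine lt_of_le_of_lt (pow_le_pow_left₀ (hF0 _) (hFmono ?_) n) hn
    nlinarith [ha n]

/-- Convergence of types along `n ↦ 2 n`. -/
theorem tendsto_norming_double (hγ : γ < 0) {F : ℝ → ℝ} (hFmono : Monotone F)
    (hF0 : ∀ x, 0 ≤ F x) {a b : ℕ → ℝ} (ha : ∀ n, 0 < a n)
    (hlim : ∀ x : ℝ, Tendsto (fun n : ℕ => F (a n * x + b n) ^ n) atTop (𝓝 (gev γ x)))
    {x : ℝ} (hx : 0 < 1 + γ * x) :
    Tendsto (fun n : ℕ => (a (2 * n) * x + b (2 * n) - b n) / a n) atTop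
      (𝓝 (((2 : ℝ) ^ γ * (1 + γ * x) - 1) / γ)) := by
  set x' := ((2 : ℝ) ^ γ * (1 + γ * x) - 1) / γ with hx'
  have h2γ : (0 : ℝ) < 2 ^ γ := Real.rpow_pos_of_pos two_pos _
  have hx'' : 1 + γ * x' = (2 : ℝ) ^ γ * (1 + γ * x) := by
    rw [hx']
    field_simp [hγ.ne]
    ring
  have hx'pos : 0 < 1 + γ * x' := by rw [hx'']; positivity
  have hhalf : gevTail γ x' = gevTail γ x / 2 := by
    unfold gevTail
    rw [hx'', max_eq_right (by positivity), max_eq_right hx.le,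
      Real.mul_rpow h2γ.le hx.le, ← Real.rpow_mul two_pos.le]
    have : γ * -(1 / γ) = -1 := by field_simp [hγ.ne]
    rw [this, Real.rpow_neg_one]
    ring
  -- Square root of the limit along even indices: the exponent `2n` becomes `n` and the exponent of
  -- the limit is halved, which amounts to moving from `x` to `x'`.
  have hmain : Tendsto (fun n : ℕ => F (a (2 * n) * x + b (2 * n)) ^ n) atTop
      (𝓝 (Real.exp (-gevTail γ x'))) := by
    have h1 := (hlim x).comp (tendsto_id.const_mul_atTop' (two_pos : 0 < 2))
    have h2 := (Real.continuous_sqrt.tendsto _).comp h1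
    rw [gev_eq_exp_neg_gevTail hγ, Real.sqrt_eq_rpow, ← Real.exp_mul] at h2
    have h3 : -gevTail γ x * (1 / 2) = -gevTail γ x' := by rw [hhalf]; ring
    rw [h3] at h2
    refine h2.congr fun n => ?_
    simp only [Function.comp, id]
    rw [mul_comm 2 n, pow_mul, Real.sqrt_sq (pow_nonneg (hF0 _) _)]
  have hy : ∀ n, a (2 * n) * x + b (2 * n) =
      a n * ((a (2 * n) * x + b (2 * n) - b n) / a n) + b n := by
    intro n
    have := (ha n).ne'
    field_simp
    ring
  -- The limit function is strictly monotone at `x'`, so comparing the powers at `x'` and at a fixed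
  -- `q ≠ x'` locates the rescaled point relative to `q`.
  rw [tendsto_order]
  constructor
  · intro q hq
    have hq' : 0 < 1 + γ * q := by nlinarith
    have h1 := hlim q
    rw [gev_eq_exp_neg_gevTail hγ] at h1
    have h2 : Real.exp (-gevTail γ q) < Real.exp (-gevTail γ x') := by
      have := gevTail_lt hγ hq hq'
      gcongr
    filter_upwards [h1.eventually_lt hmain h2] with n hn
    by_contra! hcon
    refine hn.not_ge (pow_le_pow_left₀ (hF0 _) (hFmono ?_) n)
    rw [hy n]
    nlinarith [ha n]
  · intro q hq
    have h1 := hlim q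
    rw [gev_eq_exp_neg_gevTail hγ] at h1
    have h2 : Real.exp (-gevTail γ x') < Real.exp (-gevTail γ q) := by
      have := gevTail_lt hγ hq hx'pos
      gcongr
    filter_upwards [hmain.eventually_lt h1 h2] with n hn
    by_contra! hcon
    refine hn.not_ge (pow_le_pow_left₀ (hF0 _) (hFmono ?_) n)
    rw [hy n]
    nlinarith [ha n]

/-- A distribution function in the domain of attraction of `H_γ`, `γ < 0`, has a finite right
endpoint `τ`, and `(τ - b_n) / a_n → -1/γ`. -/
theorem exists_endpoint (hγ : γ < 0) {F : ℝ → ℝ} (hFmono : Monotone F)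
    (hFcont : Continuous F) (hF0 : ∀ x, 0 ≤ F x) (hFbot : Tendsto F atBot (𝓝 0))
    {a b : ℕ → ℝ} (ha : ∀ n, 0 < a n)
    (hlim : ∀ x : ℝ, Tendsto (fun n : ℕ => F (a n * x + b n) ^ n) atTop (𝓝 (gev γ x))) :
    ∃ τ : ℝ, (∀ x, F x < 1 ↔ x < τ) ∧
      Tendsto (fun n => (τ - b n) / a n) atTop (𝓝 (-(1 / γ))) := by
  -- The endpoint `-1/γ` of the limit law, transported to the original scale: `e n` approximates `τ`
  -- with error `o(a n)`.
  set e : ℕ → ℝ := fun n => b n - a n / γ with he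
  have hx0 := tendsto_norming_double hγ hFmono hF0 ha hlim (x := 0) (by simp)
  have hx1 := tendsto_norming_double hγ hFmono hF0 ha hlim (x := -1) (by linarith)
  have hratio : Tendsto (fun n : ℕ => a (2 * n) / a n) atTop (𝓝 ((2 : ℝ) ^ γ)) := by
    have := hx0.sub hx1
    have h2 : ((2 : ℝ) ^ γ * (1 + γ * 0) - 1) / γ - ((2 : ℝ) ^ γ * (1 + γ * -1) - 1) / γ
        = (2 : ℝ) ^ γ := by
      field_simp [hγ.ne]
      ring
    rw [h2] at this
    refine this.congr fun n => ?_
    have := (ha n).ne'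
    field_simp
    ring
  have hediff : Tendsto (fun n : ℕ => (e (2 * n) - e n) / a n) atTop (𝓝 0) := by
    have := hx0.sub ((hratio.sub_const 1).div_const γ)
    have h2 : ((2 : ℝ) ^ γ * (1 + γ * 0) - 1) / γ - ((2 : ℝ) ^ γ - 1) / γ = 0 := by ring
    rw [h2] at this
    refine this.congr fun n => ?_
    have h3 := (ha n).ne'
    have h4 := hγ.ne
    simp only [he]
    field_simp
    ring
  have h2γ : (0 : ℝ) < 2 ^ γ := Real.rpow_pos_of_pos two_pos _
  have h2γ' : (2 : ℝ) ^ γ < 1 := Real.rpow_lt_one_of_one_lt_of_neg one_lt_two hγ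
  set ρ : ℝ := ((2 : ℝ) ^ γ + 1) / 2 with hρ
  have hρ0 : 0 < ρ := by rw [hρ]; positivity
  have hρ1 : ρ < 1 := by rw [hρ]; linarith
  have hexp : Real.exp (-gevTail γ 0) = Real.exp (-1) := by simp [gevTail]
  -- `F w ^ n` tends to 0 but `F (b n) ^ n` tends to `exp (-1)`.
  have hlt_b : ∀ w, F w < 1 → ∀ᶠ n in atTop, w < b n := by
    intro w hw
    have h1 := tendsto_pow_atTop_nhds_zero_of_lt_one (hF0 w) hw
    have h2 := hlim 0
    rw [gev_eq_exp_neg_gevTail hγ] at h2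
    filter_upwards [h1.eventually_lt h2 (Real.exp_pos _)] with n hn
    by_contra! hcon
    refine hn.not_ge (pow_le_pow_left₀ (hF0 _) (hFmono ?_) n)
    linarith
  -- Along `n, 2n, 4n, …` the increments of `e` are at most `A` times scales contracting by `ρ`, so
  -- `e` gains at most `A/(1-ρ) * a n = ε * a n` in total. Any `w` with `F w < 1` is eventually
  -- overtaken by `b ≤ e`.
  have hupper : ∀ ε : ℝ, 0 < ε → ∀ᶠ n in atTop, ∀ w, F w < 1 → w ≤ e n + ε * a n := by
    intro ε hε
    set A : ℝ := ε * (1 - ρ) with hA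
    have hApos : 0 < A := mul_pos hε (by linarith)
    have hev1 := hediff.eventually (gt_mem_nhds hApos)
    have hev2 := hratio.eventually (gt_mem_nhds (show (2 : ℝ) ^ γ < ρ by rw [hρ]; linarith))
    obtain ⟨N, hN⟩ := eventually_atTop.mp (hev1.and hev2)
    filter_upwards [eventually_ge_atTop (max N 1)] with n hn w hw
    have hnN : N ≤ n := (le_max_left _ _).trans hn
    have hn1 : 1 ≤ n := (le_max_right _ _).trans hn
    have hge : ∀ m, N ≤ 2 ^ m * n := fun m =>
      hnN.trans (Nat.le_mul_of_pos_left n (by positivity))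
    have hstep : ∀ m : ℕ, 2 ^ (m + 1) * n = 2 * (2 ^ m * n) := fun m => by ring
    have hgeo := sub_le_of_geometric (u := fun m => e (2 ^ m * n)) (h := fun m => a (2 ^ m * n))
      hApos.le hρ0.le hρ1 (ha _).le
      (fun m => by
        have := (hN _ (hge m)).1
        rw [div_lt_iff₀ (ha _)] at this
        simp only [hstep]
        exact this.le)
      (fun m => by
        have := (hN _ (hge m)).2
        rw [div_lt_iff₀ (ha _)] at this
        simp only [hstep]
        exact this.le)
    have htend : Tendsto (fun m : ℕ => 2 ^ m * n) atTop atTop :=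
      (tendsto_pow_atTop_atTop_of_one_lt one_lt_two).atTop_mul_const' (by omega)
    obtain ⟨m, hm⟩ := (htend.eventually (hlt_b w hw)).exists
    have h3 := hgeo m
    have h4 : A * a (2 ^ 0 * n) / (1 - ρ) = ε * a n := by
      have : 1 - ρ ≠ 0 := by linarith
      rw [hA, pow_zero, one_mul]
      field_simp
    beta_reduce at h3
    rw [h4, pow_zero, one_mul] at h3
    have h5 : b (2 ^ m * n) ≤ e (2 ^ m * n) := by
      simp only [he]
      have := div_nonpos_of_nonneg_of_nonpos (ha (2 ^ m * n)).le hγ.le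
      linarith
    linarith
  set S : Set ℝ := {x | F x < 1} with hS
  have hSne : S.Nonempty := (hFbot.eventually (gt_mem_nhds zero_lt_one)).exists
  have hSbdd : BddAbove S := by
    obtain ⟨n, hn⟩ := (hupper 1 one_pos).exists
    exact ⟨_, fun w hw => hn w hw⟩
  have hτ : ∀ x, F x < 1 ↔ x < sSup S := by
    intro x
    constructor
    · intro hx
      obtain ⟨y, hxy, hy⟩ := ((frequently_gt_nhds x).and_eventually
        (hFcont.continuousAt.eventually (gt_mem_nhds hx))).exists
      exact hxy.trans_le (le_csSup hSbdd hy)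
    · intro hx
      obtain ⟨w, hw, hxw⟩ := exists_lt_of_lt_csSup hSne hx
      exact (hFmono hxw.le).trans_lt hw
  refine ⟨sSup S, hτ, ?_⟩
  have hform : ∀ n, (e n - b n) / a n = -(1 / γ) := by
    intro n
    simp only [he]
    have h3 := (ha n).ne'
    have h4 := hγ.ne
    field_simp
    ring
  rw [tendsto_order]
  constructor
  · intro q hq
    have hq' : 0 < 1 + γ * q := by
      have : γ * q > γ * -(1 / γ) := mul_lt_mul_of_neg_left hq hγ
      have h2 : γ * -(1 / γ) = -1 := by field_simp [hγ.ne]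
      linarith
    have h1 := hlim q
    rw [gev_eq_exp_neg_gevTail hγ] at h1
    have h2 : Real.exp (-gevTail γ q) < 1 := by
      rw [Real.exp_lt_one_iff, neg_lt_zero]
      exact (gevTail_nonneg _).trans_lt (gevTail_lt hγ (lt_add_one q) hq')
    filter_upwards [h1.eventually (gt_mem_nhds h2)] with n hn
    have h3 : F (a n * q + b n) < 1 := by
      by_contra! hcon
      exact hn.not_ge (one_le_pow₀ hcon)
    rw [lt_div_iff₀ (ha n)]
    linarith [(hτ _).mp h3]
  · intro q hq
    have hε : 0 < (q - -(1 / γ)) / 2 := by linarith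
    filter_upwards [hupper _ hε] with n hn
    have h1 : sSup S ≤ e n + (q - -(1 / γ)) / 2 * a n := csSup_le hSne fun w hw => hn w hw
    have h2 := hform n
    rw [div_eq_iff (ha n).ne'] at h2
    rw [div_lt_iff₀ (ha n)]
    nlinarith [ha n]

/-- `F` is regularly varying at its finite right endpoint, in the form of inequalities. -/
theorem tail_le_and_ge_of_inDomainOfAttraction (hγ : γ < 0) {F : ℝ → ℝ} (hFmono : Monotone F)
    (hFcont : Continuous F) (hF0 : ∀ x, 0 ≤ F x) (hF1 : ∀ x, F x ≤ 1)
    (hFbot : Tendsto F atBot (𝓝 0)) (hF : InDomainOfAttraction F γ) :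
    ∃ τ : ℝ, (∀ x, F x < 1 ↔ x < τ) ∧
      (∀ ζ : ℝ, 0 < ζ → ∃ c : ℝ, 0 < c ∧
        ∀ᶠ s in 𝓝[<] τ, c * (1 - F s) ≤ 1 - F (τ - ζ * (τ - s))) ∧
      ∃ ζ : ℝ, 0 < ζ ∧ ζ < 1 ∧ ∀ᶠ s in 𝓝[<] τ, 1 - F (τ - ζ * (τ - s)) ≤ (1 - F s) / 2 := by
  obtain ⟨a, b, ha, hlim⟩ := hF
  obtain ⟨τ, hτ, hτlim⟩ := exists_endpoint hγ hFmono hFcont hF0 hFbot ha hlim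
  have hp : 0 < -(1 / γ) := by
    have := one_div_neg.mpr hγ
    linarith
  -- the limit along `τ - a_n z`
  have hz : ∀ z : ℝ, 0 ≤ z → Tendsto (fun n => F (τ - z * a n) ^ n) atTop
      (𝓝 (Real.exp (-(-γ * z) ^ (-(1 / γ))))) := by
    intro z hz
    have := tendsto_pow_of_tendsto hγ hFmono hF0 ha hlim (hτlim.sub_const z)
    rw [gevTail_endpoint_sub hγ hz] at this
    refine this.congr fun n => ?_
    congr 2
    have := (ha n).ne'
    field_simp
    ring
  have hw0 : Tendsto (fun z : ℝ => (-γ * z) ^ (-(1 / γ))) (𝓝[>] 0) (𝓝 0) := by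
    have h1 : Continuous (fun z : ℝ => (-γ * z) ^ (-(1 / γ))) :=
      (by fun_prop : Continuous fun z : ℝ => -γ * z).rpow_const fun _ => Or.inr hp.le
    have h2 := h1.tendsto 0
    simp only [mul_zero, Real.zero_rpow hp.ne'] at h2
    exact h2.mono_left nhdsWithin_le_nhds
  have hwtop : Tendsto (fun z : ℝ => (-γ * z) ^ (-(1 / γ))) atTop atTop :=
    (tendsto_rpow_atTop hp).comp (tendsto_id.const_mul_atTop (by linarith))
  have hFlow : ∀ (x : ℝ) (n : ℕ), 1 - F x ^ n ≤ n * (1 - F x) := by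
    intro x n
    have := one_add_mul_le_pow (a := F x - 1) (by linarith [hF0 x]) n
    have h2 : 1 + (F x - 1) = F x := by ring
    rw [h2] at this
    linarith
  have hFup : ∀ (x : ℝ) (n : ℕ), F x ^ n ≤ Real.exp (-(n * (1 - F x))) := by
    intro x n
    have : F x ≤ Real.exp (-(1 - F x)) := by
      have := Real.add_one_le_exp (-(1 - F x))
      linarith
    calc F x ^ n ≤ Real.exp (-(1 - F x)) ^ n := pow_le_pow_left₀ (hF0 x) this n
      _ = _ := by rw [← Real.exp_nat_mul]; ring_nf
  have hFτ : F τ = 1 := le_antisymm (hF1 τ) (not_lt.mp fun h => lt_irrefl τ ((hτ τ).mp h))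
  have htail : Tendsto (fun s => 1 - F s) (𝓝[<] τ) (𝓝[>] 0) := by
    refine tendsto_nhdsWithin_iff.mpr ⟨?_, ?_⟩
    · have : Tendsto (fun s => 1 - F s) (𝓝 τ) (𝓝 (1 - F τ)) :=
        (continuous_const.sub hFcont).tendsto τ
      rw [hFτ, sub_self] at this
      exact this.mono_left nhdsWithin_le_nhds
    · filter_upwards [self_mem_nhdsWithin] with s hs
      have := (hτ s).mpr hs
      simp only [Set.mem_Ioi]
      linarith
  have hinv : Tendsto (fun s => (1 - F s)⁻¹) (𝓝[<] τ) atTop := htail.inv_tendsto_nhdsGT_zero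
  refine ⟨τ, hτ, ?_, ?_⟩
  · intro ζ hζ
    obtain ⟨z, hz1, hz0⟩ := ((hw0.eventually (gt_mem_nhds zero_lt_one)).and
      self_mem_nhdsWithin).exists
    have hz0 : 0 < z := hz0
    set W : ℝ := (-γ * (ζ * z)) ^ (-(1 / γ)) with hW
    have hWpos : 0 < W := Real.rpow_pos_of_pos (by nlinarith [mul_pos hζ hz0]) _
    have hE : Real.exp (-W) < 1 := by rw [Real.exp_lt_one_iff]; linarith
    -- This sample size puts `n (1 - F s)` in `[1, 2]`. As the limit at `z` exceeds `exp (-1)`, `τ -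
    -- s` must exceed `z * a n`, and the limit at `ζ * z` then bounds the tail from below.
    have hn : Tendsto (fun s => ⌈(1 - F s)⁻¹⌉₊) (𝓝[<] τ) atTop :=
      tendsto_nat_ceil_atTop.comp hinv
    have hev1 := (hz z hz0.le).eventually (lt_mem_nhds
      (show Real.exp (-1) < Real.exp (-(-γ * z) ^ (-(1 / γ))) by gcongr))
    have hev2 := (hz (ζ * z) (by positivity)).eventually (gt_mem_nhds
      (show Real.exp (-(-γ * (ζ * z)) ^ (-(1 / γ))) < (1 + Real.exp (-W)) / 2 by
        rw [← hW]; linarith))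
    refine ⟨(1 - Real.exp (-W)) / 4, by linarith, ?_⟩
    filter_upwards [hn.eventually hev1, hn.eventually hev2, self_mem_nhdsWithin] with s h1 h2 hs
    have hpos : 0 < 1 - F s := by have := (hτ s).mpr hs; linarith
    set n := ⌈(1 - F s)⁻¹⌉₊ with hndef
    have hn1 : 1 ≤ (n : ℝ) * (1 - F s) := by
      have := Nat.le_ceil (1 - F s)⁻¹
      rwa [inv_le_iff_one_le_mul₀ hpos] at this
    have hn2 : (n : ℝ) * (1 - F s) ≤ 2 := by
      have h3 := (Nat.ceil_lt_add_one (inv_nonneg.mpr hpos.le)).le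
      have h4 := mul_le_mul_of_nonneg_right h3 hpos.le
      rw [add_mul, inv_mul_cancel₀ hpos.ne', one_mul] at h4
      linarith [hF0 s]
    have hya : z * a n < τ - s := by
      by_contra! hcon
      have h3 : F (τ - z * a n) ≤ F s := hFmono (by linarith)
      have h4 := h1.trans_le (pow_le_pow_left₀ (hF0 _) h3 n)
      have h5 := h4.trans_le (hFup s n)
      rw [Real.exp_lt_exp] at h5
      linarith
    have h3 : F (τ - ζ * (τ - s)) ≤ F (τ - ζ * z * a n) := hFmono (by nlinarith)
    have h4 := hFlow (τ - ζ * z * a n) n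
    have h5 : (1 - Real.exp (-W)) / 2 ≤ n * (1 - F (τ - ζ * (τ - s))) := by
      have : (n : ℝ) * (1 - F (τ - ζ * z * a n)) ≤ n * (1 - F (τ - ζ * (τ - s))) := by gcongr
      linarith
    have hn0 : (0 : ℝ) < n := by
      by_contra! h
      have : (n : ℝ) * (1 - F s) ≤ 0 := mul_nonpos_of_nonpos_of_nonneg h hpos.le
      linarith
    have h6 : (n : ℝ) * ((1 - Real.exp (-W)) / 4 * (1 - F s)) ≤
        n * (1 - F (τ - ζ * (τ - s))) := by
      have : (1 - Real.exp (-W)) / 4 * (n * (1 - F s)) ≤ (1 - Real.exp (-W)) / 4 * 2 :=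
        mul_le_mul_of_nonneg_left hn2 (by linarith)
      nlinarith
    exact le_of_mul_le_mul_left h6 hn0
  · obtain ⟨z, hz1, hz0⟩ := ((hwtop.eventually_gt_atTop 1).and (eventually_gt_atTop 0)).exists
    have hζev : Tendsto (fun ζ : ℝ => ζ * z) (𝓝[>] 0) (𝓝[>] 0) := by
      refine tendsto_nhdsWithin_iff.mpr ⟨?_, ?_⟩
      · have : Tendsto (fun ζ : ℝ => ζ * z) (𝓝 0) (𝓝 (0 * z)) := by
          exact (continuous_id.mul continuous_const).tendsto 0
        rw [zero_mul] at this
        exact this.mono_left nhdsWithin_le_nhds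
      · filter_upwards [self_mem_nhdsWithin] with ζ hζ
        exact mul_pos hζ hz0
    obtain ⟨ζ, ⟨hζ2, hζ1⟩, hζ0⟩ := (((hζev.eventually
      (hw0.eventually (gt_mem_nhds (show (0 : ℝ) < 1 / 16 by norm_num)))).and
      (nhdsWithin_le_nhds (gt_mem_nhds (zero_lt_one' ℝ)))).and self_mem_nhdsWithin).exists
    have hζ0 : 0 < ζ := hζ0
    refine ⟨ζ, hζ0, hζ1, ?_⟩
    -- Now `n (1 - F s)` lies in `[1/4, 1/2]`. The limit at `z` is below `1/2`, forcing `τ - s < z *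
    -- a n`. The limit at `ζ * z` gives a rescaled tail below `1/16`, hence below half of `1/4`.
    have hn : Tendsto (fun s => ⌊(1 - F s)⁻¹ * (1 / 2)⌋₊) (𝓝[<] τ) atTop :=
      tendsto_nat_floor_atTop.comp (hinv.atTop_mul_const (by norm_num))
    have he1 : Real.exp (-1) < 1 / 2 := by
      have := Real.exp_one_gt_d9
      rw [Real.exp_neg, inv_lt_comm₀ (Real.exp_pos _) (by norm_num)]
      linarith
    have hev1 := (hz z hz0.le).eventually (gt_mem_nhds
      (show Real.exp (-(-γ * z) ^ (-(1 / γ))) < 1 / 2 from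
        lt_trans (by gcongr) he1))
    have hev2 := (hz (ζ * z) (by positivity)).eventually (lt_mem_nhds
      (show Real.exp (-(1 / 16)) < Real.exp (-(-γ * (ζ * z)) ^ (-(1 / γ))) by gcongr))
    filter_upwards [hn.eventually hev1, hn.eventually hev2, self_mem_nhdsWithin,
      htail.eventually (nhdsWithin_le_nhds (gt_mem_nhds (show (0 : ℝ) < 1 / 4 by norm_num)))]
      with s h1 h2 hs hs4
    have hpos : 0 < 1 - F s := by have := (hτ s).mpr hs; linarith
    set n := ⌊(1 - F s)⁻¹ * (1 / 2)⌋₊ with hndef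
    have hn1 : (n : ℝ) * (1 - F s) ≤ 1 / 2 := by
      have h3 := Nat.floor_le (mul_nonneg (inv_nonneg.mpr hpos.le) (by norm_num : (0:ℝ) ≤ 1 / 2))
      have h4 := mul_le_mul_of_nonneg_right h3 hpos.le
      rw [mul_right_comm, inv_mul_cancel₀ hpos.ne', one_mul] at h4
      exact h4
    have hn2 : 1 / 4 ≤ (n : ℝ) * (1 - F s) := by
      have h3 := (Nat.lt_floor_add_one ((1 - F s)⁻¹ * (1 / 2))).le
      have h4 := mul_le_mul_of_nonneg_right h3 hpos.le
      rw [mul_right_comm, inv_mul_cancel₀ hpos.ne', one_mul, add_mul, one_mul] at h4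
      rw [← hndef] at h4
      linarith
    have hya : τ - s < z * a n := by
      by_contra! hcon
      have h3 : F s ≤ F (τ - z * a n) := hFmono (by linarith)
      have h4 := (pow_le_pow_left₀ (hF0 _) h3 n).trans_lt h1
      linarith [hFlow s n]
    have h3 : F (τ - ζ * z * a n) ≤ F (τ - ζ * (τ - s)) := hFmono (by nlinarith)
    have h4 := h2.trans_le (hFup (τ - ζ * z * a n) n)
    rw [Real.exp_lt_exp] at h4
    have hn0 : (0 : ℝ) < n := by
      by_contra! h
      have : (n : ℝ) * (1 - F s) ≤ 0 := mul_nonpos_of_nonpos_of_nonneg h hpos.le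
      linarith
    have h5 : (n : ℝ) * (1 - F (τ - ζ * (τ - s))) ≤ n * (1 - F (τ - ζ * z * a n)) := by gcongr
    have h6 : (n : ℝ) * (1 - F (τ - ζ * (τ - s))) ≤ n * ((1 - F s) / 2) := by linarith
    exact le_of_mul_le_mul_left h6 hn0

/-! ### The tail quantile function -/

variable {H : ℝ → ℝ} {τ : ℝ}

theorem apply_tailQuantile (hmono : Monotone H) (hcont : Continuous H)
    (hbot : Tendsto H atBot (𝓝 0)) (htop : Tendsto H atTop (𝓝 1)) {t : ℝ} (ht : 1 < t) :
    H (tailQuantile H t) = 1 - 1 / t := by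
  have h0 : 0 < 1 - 1 / t := by
    rw [sub_pos, div_lt_one (by linarith)]
    exact ht
  have h1 : 1 - 1 / t < 1 := by
    have : 0 < 1 / t := by positivity
    linarith
  set S : Set ℝ := {x | 1 - 1 / t ≤ H x} with hS
  have hne : S.Nonempty := ((htop.eventually (lt_mem_nhds h1)).exists).imp fun x hx => le_of_lt hx
  obtain ⟨w, hw⟩ := (hbot.eventually (gt_mem_nhds h0)).exists
  have hbdd : BddBelow S :=
    ⟨w, fun x hx => le_of_lt (by
      by_contra! h
      exact (hmono h).not_gt (hw.trans_le hx))⟩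
  have hmem : sInf S ∈ S := (isClosed_le continuous_const hcont).csInf_mem hne hbdd
  refine le_antisymm ?_ hmem
  by_contra! hcon
  obtain ⟨y, hy, hy'⟩ := ((frequently_lt_nhds (sInf S)).and_eventually
    (hcont.continuousAt.eventually (lt_mem_nhds hcon))).exists
  exact hy.not_ge (csInf_le hbdd (le_of_lt hy'))

theorem tendsto_tailQuantile (hmono : Monotone H) (hcont : Continuous H)
    (hbot : Tendsto H atBot (𝓝 0)) (htop : Tendsto H atTop (𝓝 1)) (hτ : ∀ x, H x < 1 ↔ x < τ) :
    Tendsto (tailQuantile H) atTop (𝓝[<] τ) := by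
  have hval := fun {t : ℝ} => apply_tailQuantile hmono hcont hbot htop (t := t)
  have hlt : ∀ᶠ t in atTop, tailQuantile H t < τ := by
    filter_upwards [eventually_gt_atTop 1] with t ht
    rw [← hτ, hval ht]
    have : 0 < 1 / t := by positivity
    linarith
  refine tendsto_nhdsWithin_iff.mpr ⟨tendsto_order.mpr ⟨fun q hq => ?_, fun q hq => ?_⟩, hlt⟩
  · have h1 := (hτ q).mpr hq
    have h2 : Tendsto (fun t : ℝ => 1 - 1 / t) atTop (𝓝 (1 - 0)) := by
      simpa using tendsto_inv_atTop_zero.const_sub (1 : ℝ)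
    rw [sub_zero] at h2
    filter_upwards [h2.eventually (lt_mem_nhds h1), eventually_gt_atTop 1] with t ht ht1
    rw [← hval ht1] at ht
    by_contra! hcon
    exact (hmono hcon).not_gt ht
  · filter_upwards [hlt] with t ht
    exact ht.trans hq

/-- Below the right endpoint the logarithmic excess of `U` is of the order of the auxiliary
function. -/
theorem log_endpoint_sub_le {U a : ℝ → ℝ} {γ : ℝ} (hγ : γ < 0) (hτ : 0 < τ)
    (hU : Tendsto U atTop (𝓝 τ)) (ha : IsLogAuxiliary U γ a) :
    (∀ᶠ t in atTop, 0 < a t / U t) ∧ ∀ x : ℝ, 0 < x → ∃ R : ℝ, 0 ≤ R ∧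
      ∀ᶠ t in atTop, Real.log τ - Real.log (U (t * x)) ≤ R * (a t / U t) := by
  obtain ⟨hapos, hlim⟩ := ha
  have hpos : ∀ᶠ t in atTop, 0 < a t / U t := by
    filter_upwards [eventually_gt_atTop 1, hU.eventually (lt_mem_nhds hτ)] with t h1 h2
    exact div_pos (hapos t h1) h2
  refine ⟨hpos, ?_⟩
  set h : ℝ → ℝ := fun t => a t / U t with hh
  set l : ℝ → ℝ := fun t => Real.log (U t) with hl
  have h2γ : (0 : ℝ) < 2 ^ γ := Real.rpow_pos_of_pos two_pos _
  have h2γ' : (2 : ℝ) ^ γ < 1 := Real.rpow_lt_one_of_one_lt_of_neg one_lt_two hγ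
  set d : ℝ := ((2 : ℝ) ^ γ - 1) / γ with hd
  have hdpos : 0 < d := div_pos_of_neg_of_neg (by linarith) hγ
  have h4 : (4 : ℝ) ^ γ = 2 ^ γ * 2 ^ γ := by
    rw [← Real.mul_rpow two_pos.le two_pos.le]
    norm_num
  have htwo : Tendsto (fun t : ℝ => t * 2) atTop atTop := tendsto_id.atTop_mul_const two_pos
  have hlim2 := hlim 2 two_pos
  -- The increment of `log U` from `2t` to `4t`, normalised once by `h t` and once by `h (2t)`; the
  -- quotient of the two limits is `2^γ`.
  have hratio : Tendsto (fun t => h (t * 2) / h t) atTop (𝓝 ((2 : ℝ) ^ γ)) := by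
    have h1 := (hlim 4 (by norm_num)).sub hlim2
    have h2 := hlim2.comp htwo
    have h3 := h1.div h2 hdpos.ne'
    have h5 : (((4 : ℝ) ^ γ - 1) / γ - (2 ^ γ - 1) / γ) / ((2 ^ γ - 1) / γ) = 2 ^ γ := by
      rw [h4]
      have : (2 : ℝ) ^ γ - 1 ≠ 0 := by linarith
      have := hγ.ne
      field_simp
      ring
    rw [h5] at h3
    refine h3.congr' ?_
    filter_upwards [hpos, htwo.eventually hpos, h2.eventually (lt_mem_nhds hdpos)]
      with t ht1 ht2 ht3
    simp only [Function.comp, Pi.div_apply] at ht3 ⊢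
    have e : t * 2 * 2 = t * 4 := by ring
    rw [e] at ht3 ⊢
    change 0 < (l (t * 4) - l (t * 2)) / h (t * 2) at ht3
    change ((l (t * 4) - l t) / h t - (l (t * 2) - l t) / h t) /
      ((l (t * 4) - l (t * 2)) / h (t * 2)) = h (t * 2) / h t
    change 0 < h t at ht1
    change 0 < h (t * 2) at ht2
    have h6 : 0 < l (t * 4) - l (t * 2) := by
      have := mul_pos ht3 ht2
      rwa [div_mul_cancel₀ _ ht2.ne'] at this
    rw [← sub_div, sub_sub_sub_cancel_right]
    field_simp
  set ρ : ℝ := ((2 : ℝ) ^ γ + 1) / 2 with hρ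
  have hρ0 : 0 < ρ := by rw [hρ]; positivity
  have hρ1 : ρ < 1 := by rw [hρ]; linarith
  have hll : Tendsto l atTop (𝓝 (Real.log τ)) := hU.log hτ.ne'
  -- Telescoping along `t * 2 ^ m` with contracting scale `h`, then `m → ∞`.
  have hmain : ∀ᶠ t in atTop, Real.log τ - l t ≤ (d + 1) / (1 - ρ) * h t := by
    obtain ⟨T, hT⟩ := eventually_atTop.mp
      (((hratio.eventually (gt_mem_nhds (show (2 : ℝ) ^ γ < ρ by rw [hρ]; linarith))).and
        (hlim2.eventually (gt_mem_nhds (lt_add_one d)))).and hpos)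
    filter_upwards [eventually_ge_atTop T, eventually_gt_atTop 0] with t ht ht0
    have hge : ∀ m : ℕ, T ≤ t * 2 ^ m := fun m =>
      ht.trans (le_mul_of_one_le_right ht0.le (one_le_pow₀ one_le_two))
    have hstep : ∀ m : ℕ, t * 2 ^ (m + 1) = t * 2 ^ m * 2 := fun m => by ring
    have hgeo := sub_le_of_geometric (u := fun m => l (t * 2 ^ m)) (h := fun m => h (t * 2 ^ m))
      (A := d + 1) (by linarith) hρ0.le hρ1 (hT _ (hge 0)).2.le
      (fun m => by
        obtain ⟨⟨-, h2⟩, h3⟩ := hT _ (hge m)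
        rw [div_lt_iff₀ h3] at h2
        simp only [hstep]
        exact h2.le)
      (fun m => by
        obtain ⟨⟨h1, -⟩, h3⟩ := hT _ (hge m)
        rw [div_lt_iff₀ h3] at h1
        simp only [hstep]
        exact h1.le)
    have htend : Tendsto (fun m : ℕ => t * (2 : ℝ) ^ m) atTop atTop :=
      (tendsto_pow_atTop_atTop_of_one_lt one_lt_two).const_mul_atTop ht0
    have h7 := le_of_tendsto ((hll.comp htend).sub_const (l (t * 2 ^ 0)))
      (Eventually.of_forall hgeo)
    simp only [pow_zero, mul_one] at h7
    calc _ ≤ _ := h7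
      _ = _ := by ring
  intro x hx
  have hlimx := hlim x hx
  refine ⟨(d + 1) / (1 - ρ) + (|(x ^ γ - 1) / γ| + 1), ?_, ?_⟩
  · have : 0 ≤ (d + 1) / (1 - ρ) := div_nonneg (by linarith) (by linarith)
    positivity
  · have hlow : -(|(x ^ γ - 1) / γ| + 1) < (x ^ γ - 1) / γ := by
      linarith [neg_abs_le ((x ^ γ - 1) / γ)]
    filter_upwards [hmain, hpos, hlimx.eventually (lt_mem_nhds hlow)] with t h1 h2 h3
    rw [lt_div_iff₀ h2] at h3
    change Real.log τ - Real.log (U t) ≤ (d + 1) / (1 - ρ) * (a t / U t) at h1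
    rw [add_mul]
    linarith

/-! ### Order statistics -/

section Deterministic

variable {x c : ℕ → ℝ} {n k : ℕ}

theorem rankIndex_eq {z : ℕ → ℝ} {i : ℕ} (hi : i - 1 < n) :
    rankIndex n z i = (Tuple.sort (fun j : Fin n => z j) ⟨i - 1, hi⟩ : ℕ) := by
  rw [rankIndex, dif_pos hi]

theorem rankIndex_lt {z : ℕ → ℝ} {i : ℕ} (hi : i ∈ Finset.Icc 1 n) : rankIndex n z i < n := by
  rw [Finset.mem_Icc] at hi
  rw [rankIndex_eq (by omega)]
  exact Fin.is_lt _

theorem rankIndex_bijOn (n : ℕ) (z : ℕ → ℝ) :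
    Set.BijOn (rankIndex n z) (Finset.Icc 1 n : Finset ℕ) (Finset.range n : Finset ℕ) := by
  refine ⟨fun i hi => ?_, fun i hi j hj h => ?_, fun l hl => ?_⟩
  · rw [Finset.mem_coe] at hi ⊢
    exact Finset.mem_range.mpr (rankIndex_lt hi)
  · rw [Finset.mem_coe, Finset.mem_Icc] at hi hj
    rw [rankIndex_eq (by omega), rankIndex_eq (by omega)] at h
    have := (Tuple.sort (fun j : Fin n => z j)).injective (Fin.ext h)
    simp only [Fin.mk.injEq] at this
    omega
  · rw [Finset.mem_coe, Finset.mem_range] at hl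
    set p := (Tuple.sort (fun j : Fin n => z j)).symm ⟨l, hl⟩ with hp
    refine ⟨p + 1, ?_, ?_⟩
    · rw [Finset.mem_coe, Finset.mem_Icc]
      omega
    · rw [rankIndex_eq (by simp)]
      simp [hp]

theorem obsOrd_le {i j : ℕ} (hi : 1 ≤ i) (hij : i ≤ j) (hj : j ≤ n) :
    obsOrd x c n i ≤ obsOrd x c n j := by
  unfold obsOrd
  rw [rankIndex_eq (by omega), rankIndex_eq (by omega)]
  exact Tuple.monotone_sort (fun j : Fin n => obs x c j)
    (show (⟨i - 1, by omega⟩ : Fin n) ≤ ⟨j - 1, by omega⟩ by simp; omega)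

theorem obsOrd_lt (hinj : Set.InjOn (obs x c) (Set.Iio n)) {i j : ℕ} (hi : 1 ≤ i) (hij : i < j)
    (hj : j ≤ n) : obsOrd x c n i < obsOrd x c n j := by
  refine lt_of_le_of_ne (obsOrd_le hi hij.le hj) fun h => ?_
  have hi' : i ∈ Finset.Icc 1 n := by rw [Finset.mem_Icc]; omega
  have hj' : j ∈ Finset.Icc 1 n := by rw [Finset.mem_Icc]; omega
  have := (rankIndex_bijOn n (obs x c)).injOn (by exact_mod_cast hi') (by exact_mod_cast hj')
    (hinj (rankIndex_lt hi') (rankIndex_lt hj') h)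
  omega

theorem uncOrd_eq_zero_or_one (i : ℕ) : uncOrd x c n i = 0 ∨ uncOrd x c n i = 1 := by
  unfold uncOrd unc
  split_ifs <;> simp

theorem logExcess_self {α : ℝ} (hα : 1 ≤ α) : logExcess α x c n k (n - k) = 0 := by
  unfold logExcess
  have : Real.log (obsOrd x c n (n - k) / obsOrd x c n (n - k)) = 0 := by
    rcases eq_or_ne (obsOrd x c n (n - k)) 0 with h | h
    · simp [h]
    · simp [div_self h]
  rw [this, Real.zero_rpow (by linarith)]

/-! ### The Kaplan-Meier weights -/

/-- The Kaplan-Meier factor `(n - i) / (n - i + 1)`. -/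
def kmFactor (n i : ℕ) : ℝ := ((n : ℝ) - i) / ((n : ℝ) - i + 1)

theorem kmFactor_pos {i : ℕ} (hi : i < n) : 0 < kmFactor n i := by
  have : (i : ℝ) < n := by exact_mod_cast hi
  exact div_pos (by linarith) (by linarith)

theorem one_sub_kmF_obsOrd (hinj : Set.InjOn (obs x c) (Set.Iio n)) {j : ℕ} (hj : 1 ≤ j)
    (hjn : j ≤ n) :
    1 - kmF x c n (obsOrd x c n j) = ∏ i ∈ Finset.Ioc 0 j, kmFactor n i ^ uncOrd x c n i := by
  rw [kmF, sub_sub_cancel]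
  refine Finset.prod_congr ?_ fun i _ => rfl
  ext i
  simp only [Finset.mem_filter, Finset.mem_Icc, Finset.mem_Ioc]
  constructor
  · rintro ⟨⟨h1, h2⟩, h3⟩
    refine ⟨h1, ?_⟩
    by_contra! h
    exact h3.not_gt (obsOrd_lt hinj hj h h2)
  · rintro ⟨h1, h2⟩
    exact ⟨⟨h1, h2.trans hjn⟩, obsOrd_le h1 h2 hjn⟩

/-- `1 - Ĝ_n(Z_{j,n}^-)`. -/
theorem one_sub_leftLim_kmG (hinj : Set.InjOn (obs x c) (Set.Iio n)) {j : ℕ} (hjn : j + 1 ≤ n) :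
    1 - Function.leftLim (kmG x c n) (obsOrd x c n (j + 1)) =
      ∏ i ∈ Finset.Ioc 0 j, kmFactor n i ^ (1 - uncOrd x c n i) := by
  have hev : ∀ᶠ t in 𝓝[<] (obsOrd x c n (j + 1)),
      kmG x c n t = 1 - ∏ i ∈ Finset.Ioc 0 j, kmFactor n i ^ (1 - uncOrd x c n i) := by
    have h1 : ∀ᶠ t in 𝓝[<] (obsOrd x c n (j + 1)), ∀ i ∈ Finset.Ioc 0 j, obsOrd x c n i < t := by
      rw [Filter.eventually_all_finset]
      intro i hi
      rw [Finset.mem_Ioc] at hi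
      exact nhdsWithin_le_nhds (lt_mem_nhds (obsOrd_lt hinj hi.1 (by omega) hjn))
    filter_upwards [h1, self_mem_nhdsWithin] with t ht htj
    have htj : t < obsOrd x c n (j + 1) := htj
    rw [kmG]
    congr 1
    refine Finset.prod_congr ?_ fun i _ => rfl
    ext i
    simp only [Finset.mem_filter, Finset.mem_Icc, Finset.mem_Ioc]
    constructor
    · rintro ⟨⟨h2, h3⟩, h4⟩
      refine ⟨h2, ?_⟩
      by_contra! h
      exact (h4.trans_lt htj).not_ge (obsOrd_le (by omega) (by omega) h3)
    · rintro ⟨h2, h3⟩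
      exact ⟨⟨h2, by omega⟩, (ht i (Finset.mem_Ioc.mpr ⟨h2, h3⟩)).le⟩
  have := leftLim_eq_of_tendsto (f := kmG x c n) (a := obsOrd x c n (j + 1))
    (tendsto_const_nhds.congr' (hev.mono fun t ht => ht.symm))
  rw [this, sub_sub_cancel]

/-- Summation by parts for the Kaplan-Meier weights. -/
theorem sum_weights_by_parts {w L : ℕ → ℝ} {d : ℕ → ℕ}
    (hw : ∀ i, 1 ≤ i → i < k → (i : ℝ) * w i = ((i : ℝ) + 1 - d (i + 1)) * w (i + 1))
    (hk : 1 ≤ k) :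
    ∑ i ∈ Finset.Icc 1 k, w i * (i * (L i - L (i + 1))) =
      ∑ i ∈ Finset.Icc 1 k, d i * w i * L i + (1 - d 1) * (w 1 * L 1) - k * w k * L (k + 1) := by
  induction k, hk using Nat.le_induction with
  | base => simp; ring
  | succ m hm ih =>
    rw [Finset.sum_Icc_succ_top (by omega), Finset.sum_Icc_succ_top (by omega),
      ih fun i h1 h2 => hw i h1 (by omega), hw m hm (by omega)]
    push_cast
    ring

/-- Summation by parts with ranks counted from the top. The boundary term at `k + 1` vanishes
because the log excess at rank `n - k` is zero; the one at the maximum is the defect. -/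
theorem momentL_eq {α : ℝ} (hα : 1 ≤ α) (hk : 1 ≤ k) (hkn : k < n)
    (hinj : Set.InjOn (obs x c) (Set.Iio n)) :
    momentL α x c n k = momentKM α x c n k +
      (1 - (uncOrd x c n n : ℝ)) * maxTerm α x c n k := by
  have hW : ∀ j, j < n → 1 - Function.leftLim (kmG x c n) (obsOrd x c n (n - (j + 1) + 1)) =
      ∏ i ∈ Finset.Ioc 0 (n - (j + 1)), kmFactor n i ^ (1 - uncOrd x c n i) :=
    fun j hj => one_sub_leftLim_kmG hinj (by omega)
  -- The left limit stops short of rank `n`, whose factor is the only one equal to zero.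
  have hWne : ∀ j, j < n → 1 - Function.leftLim (kmG x c n) (obsOrd x c n (n - (j + 1) + 1)) ≠ 0 := by
    intro j hj
    rw [hW j hj]
    refine Finset.prod_ne_zero_iff.mpr fun i hi => pow_ne_zero _ (kmFactor_pos ?_).ne'
    rw [Finset.mem_Ioc] at hi
    omega
  have key := sum_weights_by_parts (k := k)
    (w := fun i => 1 / (1 - Function.leftLim (kmG x c n) (obsOrd x c n (n - i + 1))))
    (L := fun i => logExcess α x c n k (n + 1 - i)) (d := fun i => uncOrd x c n (n + 1 - i))
    (by
      intro i hi1 hik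
      obtain ⟨i, rfl⟩ : ∃ m, i = m + 1 := ⟨i - 1, by omega⟩
      have h1 := hWne i (by omega)
      have h2 := hWne (i + 1) (by omega)
      have h3 : (1 - Function.leftLim (kmG x c n) (obsOrd x c n (n - (i + 1) + 1))) =
          (1 - Function.leftLim (kmG x c n) (obsOrd x c n (n - (i + 1 + 1) + 1))) *
            kmFactor n (n - (i + 1)) ^ (1 - uncOrd x c n (n - (i + 1))) := by
        rw [hW i (by omega), hW (i + 1) (by omega)]
        obtain ⟨p, hp⟩ : ∃ p, n - (i + 1) = p + 1 := ⟨n - (i + 1) - 1, by omega⟩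
        rw [hp, show n - (i + 1 + 1) = p by omega,
          Finset.prod_Ioc_succ_top (Nat.zero_le p)]
      have h4 : kmFactor n (n - (i + 1)) = ((i : ℝ) + 1) / (i + 1 + 1) := by
        rw [kmFactor, Nat.cast_sub (by omega)]
        push_cast
        ring
      have h5 : n + 1 - (i + 1 + 1) = n - (i + 1) := by omega
      simp only [h5]
      rw [h4] at h3
      have h6 : ((i : ℝ) + 1) ≠ 0 := by positivity
      have h7 : ((i : ℝ) + 1 + 1) ≠ 0 := by positivity
      rcases uncOrd_eq_zero_or_one (x := x) (c := c) (n := n) (n - (i + 1)) with h | h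
      · rw [h] at h3 ⊢
        rw [h3]
        push_cast
        simp only [pow_one]
        field_simp
        ring
      · rw [h] at h3 ⊢
        rw [h3]
        push_cast
        simp only [pow_zero, mul_one]
        ring)
    hk
  have hLk : logExcess α x c n k (n + 1 - (k + 1)) = 0 := by
    rw [Nat.add_sub_add_right]
    exact logExcess_self hα
  rw [hLk, mul_zero, sub_zero] at key
  have e1 : momentL α x c n k = 1 / ((n : ℝ) * (1 - kmF x c n (obsOrd x c n (n - k)))) *
      ∑ i ∈ Finset.Icc 1 k,
        1 / (1 - Function.leftLim (kmG x c n) (obsOrd x c n (n - i + 1))) *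
          (i * (logExcess α x c n k (n + 1 - i) - logExcess α x c n k (n + 1 - (i + 1)))) := by
    unfold momentL xi
    congr 1
    refine Finset.sum_congr rfl fun i hi => ?_
    rw [Finset.mem_Icc] at hi
    rw [show n + 1 - i = n - i + 1 by omega, show n + 1 - (i + 1) = n - i by omega]
  rw [e1, key, mul_add]
  congr 1
  · unfold momentKM
    congr 1
    refine Finset.sum_congr rfl fun i hi => ?_
    rw [Finset.mem_Icc] at hi
    rw [show n + 1 - i = n - i + 1 by omega]
    ring
  · unfold maxTerm
    rw [Nat.add_sub_cancel, Nat.sub_add_cancel (by omega)]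
    generalize 1 - kmF x c n (obsOrd x c n (n - k)) = A
    generalize 1 - Function.leftLim (kmG x c n) (obsOrd x c n n) = B
    ring

/-! ### The term of the maximum -/

theorem prod_kmFactor {m : ℕ} (hm : m < n) :
    (n : ℝ) * ∏ i ∈ Finset.Ioc 0 m, kmFactor n i = n - m := by
  induction m with
  | zero => simp
  | succ m ih =>
    rw [Finset.prod_Ioc_succ_top (Nat.zero_le m), ← mul_assoc, ih (by omega)]
    have : (m : ℝ) + 1 < n := by exact_mod_cast hm
    have h2 : (n : ℝ) - m ≠ 0 := by linarith
    rw [kmFactor]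
    push_cast
    rw [sub_add_eq_sub_sub, sub_add_cancel]
    field_simp

/-- The `F̂` factors up to rank `n - k`, those of the remaining block and the `Ĝ` factors together
contain each factor of rank below `n` exactly once, and `n` times that product telescopes to 1. -/
theorem maxTerm_eq {α : ℝ} (hkn : k < n) (hinj : Set.InjOn (obs x c) (Set.Iio n)) (hk : 1 ≤ k) :
    maxTerm α x c n k =
      (∏ i ∈ Finset.Ioc (n - k) (n - 1), kmFactor n i ^ uncOrd x c n i) *
        logExcess α x c n k n := by
  have hn : n - 1 + 1 = n := by omega
  have hG := one_sub_leftLim_kmG hinj (j := n - 1) (by omega)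
  rw [hn] at hG
  rw [maxTerm, hG, one_sub_kmF_obsOrd hinj (by omega) (by omega)]
  congr 1
  have h1 : (n : ℝ) * (∏ i ∈ Finset.Ioc 0 (n - k), kmFactor n i ^ uncOrd x c n i) *
      (∏ i ∈ Finset.Ioc 0 (n - 1), kmFactor n i ^ (1 - uncOrd x c n i)) *
      (∏ i ∈ Finset.Ioc (n - k) (n - 1), kmFactor n i ^ uncOrd x c n i) = 1 := by
    have h2 := prod_kmFactor (n := n) (m := n - 1) (by omega)
    rw [Nat.cast_sub (by omega), Nat.cast_one, sub_sub_cancel] at h2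
    rw [← h2, mul_assoc (n : ℝ), mul_assoc (n : ℝ), mul_right_comm,
      Finset.prod_Ioc_consecutive _ (Nat.zero_le _) (by omega), ← Finset.prod_mul_distrib]
    congr 1
    refine Finset.prod_congr rfl fun i _ => ?_
    rcases uncOrd_eq_zero_or_one (x := x) (c := c) (n := n) i with h | h <;> simp [h]
  exact (eq_one_div_of_mul_eq_one_right h1).symm

/-- The number of observations above `s` among the first `n`. -/
def numAbove (x c : ℕ → ℝ) (n : ℕ) (s : ℝ) : ℕ := ((Finset.range n).filter (s < obs x c ·)).card

theorem card_filter_rank (p : ℕ → Prop) [DecidablePred p] (n : ℕ) (z : ℕ → ℝ) :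
    ((Finset.Icc 1 n).filter (fun i => p (rankIndex n z i))).card =
      ((Finset.range n).filter p).card := by
  have h := rankIndex_bijOn n z
  refine Finset.card_bij (fun i _ => rankIndex n z i) ?_ ?_ ?_
  · intro i hi
    rw [Finset.mem_filter] at hi ⊢
    exact ⟨by exact_mod_cast h.mapsTo (by exact_mod_cast hi.1), hi.2⟩
  · intro i hi j hj hij
    rw [Finset.mem_filter] at hi hj
    exact h.injOn (by exact_mod_cast hi.1) (by exact_mod_cast hj.1) hij
  · intro l hl
    rw [Finset.mem_filter] at hl
    obtain ⟨i, hi, rfl⟩ := h.surjOn (by exact_mod_cast hl.1 : l ∈ ((Finset.range n : Finset ℕ) : Set ℕ))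
    exact ⟨i, by rw [Finset.mem_filter]; exact ⟨by exact_mod_cast hi, hl.2⟩, rfl⟩

theorem rank_le_numAbove {s : ℝ} {i : ℕ} (hi : i ∈ Finset.Icc 1 n) (hs : s < obsOrd x c n i) :
    n + 1 - i ≤ numAbove x c n s := by
  unfold numAbove
  rw [← card_filter_rank _ n (obs x c), ← Nat.card_Icc]
  rw [Finset.mem_Icc] at hi
  refine Finset.card_le_card fun j hj => ?_
  rw [Finset.mem_Icc] at hj
  rw [Finset.mem_filter, Finset.mem_Icc]
  exact ⟨⟨by omega, hj.2⟩, hs.trans_le (obsOrd_le hi.1 hj.1 hj.2)⟩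

theorem lt_obsOrd_of_lt_numAbove {s : ℝ} (hk : k < numAbove x c n s) (hkn : k < n) :
    s < obsOrd x c n (n - k) := by
  by_contra! hcon
  refine hk.not_ge ?_
  unfold numAbove
  rw [← card_filter_rank _ n (obs x c)]
  calc _ ≤ (Finset.Icc (n - k + 1) n).card := by
        refine Finset.card_le_card fun j hj => ?_
        rw [Finset.mem_filter, Finset.mem_Icc] at hj
        rw [Finset.mem_Icc]
        refine ⟨?_, hj.1.2⟩
        by_contra! h
        have h1 : obsOrd x c n j ≤ obsOrd x c n (n - k) := obsOrd_le hj.1.1 (by omega) (by omega)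
        exact (h1.trans hcon).not_gt hj.2
    _ = k := by rw [Nat.card_Icc]; omega

/-- The number of uncensored observations in the block `(s, t]` whose censoring time is
beyond `t`. -/
def numBlock (x c : ℕ → ℝ) (n : ℕ) (s t : ℝ) : ℕ :=
  ((Finset.range n).filter (fun j => (s < x j ∧ x j ≤ t) ∧ t < c j)).card

/-- A point of rank `i` in the block lies above `s`, so `n - i + 1` is at most the number of
observations above `s`. Asking for `t < c` instead of `x ≤ c` makes the block a product event, whose
probability factorises. -/
theorem numBlock_div_le {s t : ℝ} :
    (numBlock x c n s t : ℝ) / numAbove x c n s ≤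
      ∑ i ∈ (Finset.Icc 1 n).filter (fun i => (s < x (rankIndex n (obs x c) i) ∧
          x (rankIndex n (obs x c) i) ≤ t) ∧ t < c (rankIndex n (obs x c) i)),
        1 / ((n : ℝ) - i + 1) := by
  unfold numBlock
  rw [← card_filter_rank _ n (obs x c), div_eq_mul_one_div, ← nsmul_eq_mul]
  refine Finset.card_nsmul_le_sum _ _ _ fun i hi => ?_
  rw [Finset.mem_filter] at hi
  have h1 : s < obsOrd x c n i := lt_min hi.2.1.1 ((hi.2.1.1.trans_le hi.2.1.2).trans hi.2.2)
  have h2 := rank_le_numAbove hi.1 h1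
  have h3 := Finset.mem_Icc.mp hi.1
  have h4 : (((n + 1 - i : ℕ)) : ℝ) = (n : ℝ) - i + 1 := by
    rw [Nat.cast_sub (by omega)]
    push_cast
    ring
  have h5 : (i : ℝ) ≤ n := by exact_mod_cast h3.2
  refine one_div_le_one_div_of_le (by linarith) ?_
  rw [← h4]
  exact_mod_cast h2

/-- The blocks are disjoint in the `x` coordinate, consist of uncensored points, and occupy only the
top `k` ranks since at most `k` observations exceed `s 0`. -/
theorem sum_blocks_le {s : ℕ → ℝ} (hs : Monotone s) (M : ℕ) (hN : numAbove x c n (s 0) ≤ k)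
    (hkn : k ≤ n) :
    ∑ m ∈ Finset.range M, (numBlock x c n (s m) (s (m + 1)) : ℝ) / numAbove x c n (s m) ≤
      ∑ i ∈ Finset.Ioc (n - k) n, (uncOrd x c n i : ℝ) * (1 / ((n : ℝ) - i + 1)) := by
  set r := rankIndex n (obs x c) with hr
  set S : ℕ → Finset ℕ := fun m => (Finset.Icc 1 n).filter
    (fun i => (s m < x (r i) ∧ x (r i) ≤ s (m + 1)) ∧ s (m + 1) < c (r i)) with hS
  have hmem : ∀ m i, i ∈ S m → i ∈ Finset.Ioc (n - k) n ∧ uncOrd x c n i = 1 := by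
    intro m i hi
    simp only [hS, Finset.mem_filter] at hi
    obtain ⟨h1, ⟨h2, h3⟩, h4⟩ := hi
    have h5 : s 0 < obsOrd x c n i :=
      (hs (Nat.zero_le m)).trans_lt (lt_min h2 ((h2.trans_le h3).trans h4))
    have h6 := rank_le_numAbove h1 h5
    rw [Finset.mem_Icc] at h1
    refine ⟨by rw [Finset.mem_Ioc]; omega, ?_⟩
    unfold uncOrd unc
    rw [if_pos (h3.trans h4.le)]
  have hdisj : ((Finset.range M : Finset ℕ) : Set ℕ).PairwiseDisjoint S := by
    intro m _ m' _ hmm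
    rw [Function.onFun, Finset.disjoint_left]
    intro i hi hi'
    simp only [hS, Finset.mem_filter] at hi hi'
    rcases lt_or_gt_of_ne hmm with h | h
    · exact (hi.2.1.2.trans (hs h)).not_gt hi'.2.1.1
    · exact (hi'.2.1.2.trans (hs h)).not_gt hi.2.1.1
  calc _ ≤ ∑ m ∈ Finset.range M, ∑ i ∈ S m, 1 / ((n : ℝ) - i + 1) :=
        Finset.sum_le_sum fun m _ => numBlock_div_le
    _ = ∑ i ∈ (Finset.range M).biUnion S, 1 / ((n : ℝ) - i + 1) :=
        (Finset.sum_biUnion hdisj).symm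
    _ = ∑ i ∈ (Finset.range M).biUnion S, (uncOrd x c n i : ℝ) * (1 / ((n : ℝ) - i + 1)) := by
        refine Finset.sum_congr rfl fun i hi => ?_
        obtain ⟨m, -, hm⟩ := Finset.mem_biUnion.mp hi
        rw [(hmem m i hm).2, Nat.cast_one, one_mul]
    _ ≤ _ := by
        refine Finset.sum_le_sum_of_subset_of_nonneg (fun i hi => ?_) fun i hi _ => ?_
        · obtain ⟨m, -, hm⟩ := Finset.mem_biUnion.mp hi
          exact (hmem m i hm).1
        · rw [Finset.mem_Ioc] at hi
          have : (i : ℝ) ≤ n := by exact_mod_cast hi.2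
          exact mul_nonneg (Nat.cast_nonneg _) (one_div_nonneg.mpr (by linarith))

/-- The deterministic core: `1 - u ≤ exp (-u)` turns the product of `maxTerm_eq` into the
exponential of a sum, to which each of `M` blocks contributes `κ`. -/
theorem abs_maxTerm_le {α : ℝ} (hα : 0 ≤ α) (hk : 1 ≤ k) (hkn : k < n)
    (hinj : Set.InjOn (obs x c) (Set.Iio n)) {s : ℕ → ℝ} (hs : Monotone s) (M : ℕ)
    (hN : numAbove x c n (s 0) ≤ k) {κ : ℝ}
    (hκ : ∀ m < M, κ ≤ (numBlock x c n (s m) (s (m + 1)) : ℝ) / numAbove x c n (s m))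
    {l τ : ℝ} (hl : 0 < l) (hlN : k < numAbove x c n l) (hτ : ∀ j, obs x c j ≤ τ) :
    |maxTerm α x c n k| ≤ Real.exp (1 - M * κ) * (Real.log τ - Real.log l) ^ α := by
  have hsum : M * κ ≤ ∑ i ∈ Finset.Ioc (n - k) n, (uncOrd x c n i : ℝ) * (1 / ((n : ℝ) - i + 1)) := by
    refine le_trans ?_ (sum_blocks_le hs M hN hkn.le)
    have := Finset.card_nsmul_le_sum (Finset.range M) _ κ fun m hm => hκ m (Finset.mem_range.mp hm)
    rwa [Finset.card_range, nsmul_eq_mul] at this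
  -- Rank `n` occurs in the block sum but not in the product; dropping its term costs at most 1.
  have hsum' : M * κ - 1 ≤
      ∑ i ∈ Finset.Ioc (n - k) (n - 1), (uncOrd x c n i : ℝ) * (1 / ((n : ℝ) - i + 1)) := by
    obtain ⟨p, rfl⟩ : ∃ p, n = p + 1 := ⟨n - 1, by omega⟩
    rw [← Finset.sum_Ioc_consecutive _ (show p + 1 - k ≤ p by omega) (Nat.le_succ p)] at hsum
    rw [Nat.add_sub_cancel]
    have h1 : (uncOrd x c (p + 1) (p + 1) : ℝ) ≤ 1 := by
      rcases uncOrd_eq_zero_or_one (x := x) (c := c) (n := p + 1) (p + 1) with h | h <;> simp [h]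
    simp only [Nat.Ioc_succ_singleton, Finset.sum_singleton, sub_self, zero_add, div_one,
      mul_one] at hsum
    linarith
  have hprod0 : 0 ≤ ∏ i ∈ Finset.Ioc (n - k) (n - 1), kmFactor n i ^ uncOrd x c n i :=
    Finset.prod_nonneg fun i hi => by
      rw [Finset.mem_Ioc] at hi
      exact pow_nonneg (kmFactor_pos (by omega)).le _
  have hprod : ∏ i ∈ Finset.Ioc (n - k) (n - 1), kmFactor n i ^ uncOrd x c n i ≤
      Real.exp (1 - M * κ) := by
    calc _ ≤ ∏ i ∈ Finset.Ioc (n - k) (n - 1),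
          Real.exp (-((uncOrd x c n i : ℝ) * (1 / ((n : ℝ) - i + 1)))) := by
          refine Finset.prod_le_prod (fun i hi => ?_) fun i hi => ?_
          · rw [Finset.mem_Ioc] at hi
            exact pow_nonneg (kmFactor_pos (by omega)).le _
          · rw [Finset.mem_Ioc] at hi
            have h1 : (i : ℝ) < n := by exact_mod_cast (show i < n by omega)
            have h2 : kmFactor n i ≤ Real.exp (-(1 / ((n : ℝ) - i + 1))) := by
              have := Real.add_one_le_exp (-(1 / ((n : ℝ) - i + 1)))
              refine le_trans (le_of_eq ?_) this
              rw [kmFactor]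
              have : (n : ℝ) - i + 1 ≠ 0 := by linarith
              field_simp
              ring
            calc _ ≤ Real.exp (-(1 / ((n : ℝ) - i + 1))) ^ uncOrd x c n i :=
                  pow_le_pow_left₀ (kmFactor_pos (by omega)).le h2 _
              _ = _ := by rw [← Real.exp_nat_mul]; ring_nf
      _ = Real.exp (-∑ i ∈ Finset.Ioc (n - k) (n - 1),
            ((uncOrd x c n i : ℝ) * (1 / ((n : ℝ) - i + 1)))) := by
          rw [← Real.exp_sum, Finset.sum_neg_distrib]
      _ ≤ _ := Real.exp_le_exp.mpr (by linarith)
  have hlZ := lt_obsOrd_of_lt_numAbove hlN hkn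
  have hZ : obsOrd x c n (n - k) ≤ obsOrd x c n n := obsOrd_le (by omega) (by omega) le_rfl
  have hlog0 : 0 ≤ Real.log (obsOrd x c n n / obsOrd x c n (n - k)) :=
    Real.log_nonneg ((one_le_div (hl.trans hlZ)).mpr hZ)
  have hlog : Real.log (obsOrd x c n n / obsOrd x c n (n - k)) ≤ Real.log τ - Real.log l := by
    have h0 := hl.trans hlZ
    rw [Real.log_div (h0.trans_le hZ).ne' h0.ne']
    have h1 : Real.log (obsOrd x c n n) ≤ Real.log τ :=
      Real.log_le_log (h0.trans_le hZ) (hτ _)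
    have h2 := Real.log_le_log hl hlZ.le
    linarith
  rw [maxTerm_eq hkn hinj hk, abs_mul, abs_of_nonneg hprod0]
  unfold logExcess
  rw [abs_of_nonneg (Real.rpow_nonneg hlog0 _)]
  exact mul_le_mul hprod (Real.rpow_le_rpow hlog0 hlog hα) (Real.rpow_nonneg hlog0 _)
    (Real.exp_pos _).le

end Deterministic

/-! ### Counts as sums of indicators -/

theorem sum_indicator_Ioi {Ω : Type*} {X C : ℕ → Ω → ℝ} (n : ℕ) (s : ℝ) (ω : Ω) :
    ∑ i ∈ Finset.range n, (X i ⁻¹' Set.Ioi s ∩ C i ⁻¹' Set.Ioi s).indicator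
      (fun _ => (1 : ℝ)) ω = numAbove (fun i => X i ω) (fun i => C i ω) n s := by
  classical
  simp only [Set.indicator_apply, Finset.sum_boole, numAbove, obs, lt_min_iff, Set.mem_inter_iff,
    Set.mem_preimage, Set.mem_Ioi]

theorem sum_indicator_block {Ω : Type*} {X C : ℕ → Ω → ℝ} (n : ℕ) (s t : ℝ) (ω : Ω) :
    ∑ i ∈ Finset.range n, (X i ⁻¹' Set.Ioc s t ∩ C i ⁻¹' Set.Ioi t).indicator
      (fun _ => (1 : ℝ)) ω = numBlock (fun i => X i ω) (fun i => C i ω) n s t := by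
  classical
  simp only [Set.indicator_apply, Finset.sum_boole, numBlock, Set.mem_inter_iff,
    Set.mem_preimage, Set.mem_Ioi, Set.mem_Ioc]

section Probability

variable {Ω : Type*} [MeasurableSpace Ω] {P : Measure Ω}

/-! ### Distribution functions -/

theorem cdf_map_apply [IsProbabilityMeasure P] {Y : Ω → ℝ} (hY : Measurable Y) (s : ℝ) :
    cdf (P.map Y) s = P.real (Y ⁻¹' Set.Iic s) := by
  have := Measure.isProbabilityMeasure_map (μ := P) hY.aemeasurable
  rw [cdf_eq_real, map_measureReal_apply hY measurableSet_Iic]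

theorem measureReal_preimage_Ioi [IsProbabilityMeasure P] {Y : Ω → ℝ} (hY : Measurable Y) (s : ℝ) :
    P.real (Y ⁻¹' Set.Ioi s) = 1 - cdf (P.map Y) s := by
  rw [cdf_map_apply hY, ← Set.compl_Iic, Set.preimage_compl,
    probReal_compl_eq_one_sub (hY measurableSet_Iic)]

theorem measureReal_preimage_Ioc [IsProbabilityMeasure P] {Y : Ω → ℝ} (hY : Measurable Y) {s t : ℝ} (hst : s ≤ t) :
    P.real (Y ⁻¹' Set.Ioc s t) = cdf (P.map Y) t - cdf (P.map Y) s := by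
  rw [cdf_map_apply hY, cdf_map_apply hY, show Set.Ioc s t = Set.Iic t \ Set.Iic s by ext; simp [and_comm], Set.preimage_sdiff,
    measureReal_sdiff (Set.preimage_mono (Set.Iic_subset_Iic.mpr hst)) (hY measurableSet_Iic)]

theorem nullSingletonClass_of_continuous_cdf (μ : Measure ℝ) [IsProbabilityMeasure μ]
    (h : Continuous (cdf μ)) : NullSingletonClass μ := by
  refine ⟨fun x => ?_⟩
  rw [← measure_cdf μ, StieltjesFunction.measure_singleton,
    h.continuousAt.continuousWithinAt.leftLim_eq]
  simp

/-- Fubini: the slices of the diagonal are singletons, null for the law of `Z`. -/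
theorem ae_ne_of_indepFun [IsProbabilityMeasure P] {Y Z : Ω → ℝ} (hY : Measurable Y) (hZ : Measurable Z)
    (h : IndepFun Y Z P) [NullSingletonClass (P.map Z)] : ∀ᵐ ω ∂P, Y ω ≠ Z ω := by
  have := Measure.isProbabilityMeasure_map (μ := P) hY.aemeasurable
  have := Measure.isProbabilityMeasure_map (μ := P) hZ.aemeasurable
  have hD : MeasurableSet {p : ℝ × ℝ | p.1 = p.2} := measurableSet_eq_fun measurable_fst measurable_snd
  rw [ae_iff]
  have h1 : {ω | ¬Y ω ≠ Z ω} = (fun ω => (Y ω, Z ω)) ⁻¹' {p : ℝ × ℝ | p.1 = p.2} := by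
    ext ω
    simp
  rw [h1, ← Measure.map_apply (hY.prodMk hZ) hD,
    (indepFun_iff_map_prod_eq_prod_map_map hY.aemeasurable hZ.aemeasurable).mp h,
    Measure.measure_prod_null hD]
  refine Eventually.of_forall fun x => ?_
  have h2 : Prod.mk x ⁻¹' {p : ℝ × ℝ | p.1 = p.2} = {x} := by
    ext y
    simp [eq_comm]
  beta_reduce
  rw [h2]
  simp

/-! ### Counting observations -/

variable {X C : ℕ → Ω → ℝ}

/-- A finite intersection separates into an `X` cylinder and a `C` cylinder. Independence of the two
sequences splits these, and independence within each sequence splits them further. -/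
theorem iIndepSet_preimage_inter (hXm : ∀ i, Measurable (X i)) (hCm : ∀ i, Measurable (C i))
    (hXind : iIndepFun X P) (hCind : iIndepFun C P)
    (hXC : IndepFun (fun ω i => X i ω) (fun ω i => C i ω) P) {S T : Set ℝ}
    (hS : MeasurableSet S) (hT : MeasurableSet T) :
    iIndepSet (fun i => X i ⁻¹' S ∩ C i ⁻¹' T) P := by
  rw [iIndepSet_iff_meas_biInter fun i => (hXm i hS).inter (hCm i hT)]
  intro s
  have hmeas : ∀ {A : Set ℝ} (s : Finset ℕ), MeasurableSet A →
      MeasurableSet (⋂ i ∈ s, (fun f : ℕ → ℝ => f i) ⁻¹' A) := fun s hA =>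
    Finset.measurableSet_biInter s fun i _ => measurable_pi_apply i hA
  have hpair : ∀ i, P (X i ⁻¹' S ∩ C i ⁻¹' T) = P (X i ⁻¹' S) * P (C i ⁻¹' T) := fun i =>
    (hXC.comp (measurable_pi_apply i) (measurable_pi_apply i)).measure_inter_preimage_eq_mul
      _ _ hS hT
  have h1 := hXC.measure_inter_preimage_eq_mul _ _ (hmeas s hS) (hmeas s hT)
  simp only [Set.preimage_iInter] at h1
  rw [show (⋂ i ∈ s, X i ⁻¹' S ∩ C i ⁻¹' T) = (⋂ i ∈ s, X i ⁻¹' S) ∩ ⋂ i ∈ s, C i ⁻¹' T by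
    ext ω; simp only [Set.mem_iInter, Set.mem_inter_iff]; grind]
  refine h1.trans ?_
  have h2 := hXind.measure_inter_preimage_eq_mul s (sets := fun _ => S) fun _ _ => hS
  have h3 := hCind.measure_inter_preimage_eq_mul s (sets := fun _ => T) fun _ _ => hT
  rw [Finset.prod_congr rfl fun i _ => hpair i, Finset.prod_mul_distrib, ← h2, ← h3]
  rfl

theorem measureReal_preimage_inter (hXid : ∀ i, IdentDistrib (X i) (X 0) P P)
    (hCid : ∀ i, IdentDistrib (C i) (C 0) P P)
    (hXC : IndepFun (fun ω i => X i ω) (fun ω i => C i ω) P) {S T : Set ℝ}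
    (hS : MeasurableSet S) (hT : MeasurableSet T) (i : ℕ) :
    P.real (X i ⁻¹' S ∩ C i ⁻¹' T) = P.real (X 0 ⁻¹' S) * P.real (C 0 ⁻¹' T) := by
  have h := (hXC.comp (measurable_pi_apply i) (measurable_pi_apply i)).measure_inter_preimage_eq_mul
      _ _ hS hT
  simp only [Measure.real]
  rw [← ENNReal.toReal_mul, ← (hXid i).measure_preimage_eq hS, ← (hCid i).measure_preimage_eq hT]
  exact congrArg _ h

/-- Chebyshev's inequality for the number of occurrences among independent events. -/
theorem measure_deviation_le [IsProbabilityMeasure P] {A : ℕ → Set Ω} (hA : ∀ i, MeasurableSet (A i))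
    (hind : iIndepSet A P) {p : ℝ} (hp : ∀ i, P.real (A i) = p) {n : ℕ} (hnp : 0 < n * p) :
    P {ω | n * p / 2 ≤ |∑ i ∈ Finset.range n, (A i).indicator (fun _ => (1 : ℝ)) ω - n * p|} ≤
      ENNReal.ofReal (4 / (n * p)) := by
  set Y : ℕ → Ω → ℝ := fun i => (A i).indicator fun _ => (1 : ℝ) with hY
  have hmem : ∀ i, MemLp (Y i) 2 P := fun i => (memLp_const 1).indicator (hA i)
  have hE : ∀ i, P[Y i] = p := fun i => by
    rw [hY, integral_indicator_const _ (hA i), hp i]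
    simp
  have hV : ∀ i, variance (Y i) P ≤ p := fun i => by
    -- An indicator equals its square, so its second moment is `p`.
    refine (variance_le_expectation_sq (hmem i).1).trans (le_of_eq ?_)
    rw [← hE i]
    congr 1
    ext ω
    by_cases h : ω ∈ A i <;> simp [hY, h]
  have hsum := meas_ge_le_variance_div_sq (memLp_finsetSum' (Finset.range n) fun i _ => hmem i)
    (c := n * p / 2) (by positivity)
  have hES : P[∑ i ∈ Finset.range n, Y i] = n * p := by
    simp only [Finset.sum_apply]
    rw [integral_finsetSum _ fun i _ => (hmem i).integrable one_le_two]
    simp [hE]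
  rw [hES] at hsum
  simp only [Finset.sum_apply] at hsum
  refine hsum.trans (ENNReal.ofReal_le_ofReal ?_)
  have hVS : variance (∑ i ∈ Finset.range n, Y i) P ≤ n * p := by
    rw [IndepFun.variance_sum (fun i _ => hmem i)
      fun i _ j _ hij => hind.iIndepFun_indicator.indepFun hij]
    calc _ ≤ ∑ i ∈ Finset.range n, p := Finset.sum_le_sum fun i _ => hV i
      _ = n * p := by simp
  rw [div_le_div_iff₀ (by positivity) hnp]
  nlinarith

/-- The event that the number of `i < n` with `X_i ∈ S`, `C_i ∈ T` is off its mean by half the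
mean or more. -/
def deviationEvent (P : Measure Ω) (X C : ℕ → Ω → ℝ) (n : ℕ) (S T : Set ℝ) : Set Ω :=
  {ω | n * (P.real (X 0 ⁻¹' S) * P.real (C 0 ⁻¹' T)) / 2 ≤
    |∑ i ∈ Finset.range n, (X i ⁻¹' S ∩ C i ⁻¹' T).indicator (fun _ => (1 : ℝ)) ω -
      n * (P.real (X 0 ⁻¹' S) * P.real (C 0 ⁻¹' T))|}

theorem tendsto_measure_deviationEvent [IsProbabilityMeasure P] (hXm : ∀ i, Measurable (X i)) (hCm : ∀ i, Measurable (C i))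
    (hXid : ∀ i, IdentDistrib (X i) (X 0) P P) (hCid : ∀ i, IdentDistrib (C i) (C 0) P P)
    (hXind : iIndepFun X P) (hCind : iIndepFun C P)
    (hXC : IndepFun (fun ω i => X i ω) (fun ω i => C i ω) P) {S T : ℕ → Set ℝ}
    (hS : ∀ n, MeasurableSet (S n)) (hT : ∀ n, MeasurableSet (T n))
    (h : Tendsto (fun n : ℕ => n * (P.real (X 0 ⁻¹' S n) * P.real (C 0 ⁻¹' T n))) atTop atTop) :
    Tendsto (fun n => P (deviationEvent P X C n (S n) (T n))) atTop (𝓝 0) := by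
  have h1 : Tendsto (fun n : ℕ => ENNReal.ofReal
      (4 / (n * (P.real (X 0 ⁻¹' S n) * P.real (C 0 ⁻¹' T n))))) atTop (𝓝 0) := by
    have := ENNReal.tendsto_ofReal (h.const_div_atTop 4)
    rwa [ENNReal.ofReal_zero] at this
  refine tendsto_of_tendsto_of_tendsto_of_le_of_le' tendsto_const_nhds h1
    (Eventually.of_forall fun _ => zero_le) ?_
  filter_upwards [h.eventually_gt_atTop 0] with n hn
  exact measure_deviation_le (fun i => (hXm i (hS n)).inter (hCm i (hT n)))
    (iIndepSet_preimage_inter hXm hCm hXind hCind hXC (hS n) (hT n))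
    (measureReal_preimage_inter hXid hCid hXC (hS n) (hT n)) hn

theorem one_sub_cdf_min [IsProbabilityMeasure P] (hXm : ∀ i, Measurable (X i)) (hCm : ∀ i, Measurable (C i))
    (hXid : ∀ i, IdentDistrib (X i) (X 0) P P) (hCid : ∀ i, IdentDistrib (C i) (C 0) P P)
    (hXC : IndepFun (fun ω i => X i ω) (fun ω i => C i ω) P) (s : ℝ) :
    1 - cdf (P.map fun ω => min (X 0 ω) (C 0 ω)) s =
      (1 - cdf (P.map (X 0)) s) * (1 - cdf (P.map (C 0)) s) := by
  rw [← measureReal_preimage_Ioi ((hXm 0).min (hCm 0)), ← measureReal_preimage_Ioi (hXm 0),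
    ← measureReal_preimage_Ioi (hCm 0),
    ← measureReal_preimage_inter hXid hCid hXC measurableSet_Ioi measurableSet_Ioi 0]
  congr 1
  ext ω
  simp

/-- A tie between two minima forces equality in one of four pairs of independent atomless variables,
and there are countably many index pairs. -/
theorem ae_injective_obs [IsProbabilityMeasure P] (hXm : ∀ i, Measurable (X i)) (hCm : ∀ i, Measurable (C i))
    (hXid : ∀ i, IdentDistrib (X i) (X 0) P P) (hCid : ∀ i, IdentDistrib (C i) (C 0) P P)
    (hXind : iIndepFun X P) (hCind : iIndepFun C P)
    (hXC : IndepFun (fun ω i => X i ω) (fun ω i => C i ω) P)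
    (hFcont : Continuous (cdf (P.map (X 0)))) (hGcont : Continuous (cdf (P.map (C 0)))) :
    ∀ᵐ ω ∂P, Function.Injective (obs (fun i => X i ω) (fun i => C i ω)) := by
  have hXat : ∀ i, NullSingletonClass (P.map (X i)) := fun i => by
    have := Measure.isProbabilityMeasure_map (μ := P) (hXm 0).aemeasurable
    rw [(hXid i).map_eq]
    exact nullSingletonClass_of_continuous_cdf _ hFcont
  have hCat : ∀ i, NullSingletonClass (P.map (C i)) := fun i => by
    have := Measure.isProbabilityMeasure_map (μ := P) (hCm 0).aemeasurable
    rw [(hCid i).map_eq]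
    exact nullSingletonClass_of_continuous_cdf _ hGcont
  have hpair : ∀ i j, i ≠ j → ∀ᵐ ω ∂P, X i ω ≠ X j ω ∧ X i ω ≠ C j ω ∧ X j ω ≠ C i ω ∧
      C i ω ≠ C j ω := by
    intro i j hij
    filter_upwards [ae_ne_of_indepFun (hXm i) (hXm j) (hXind.indepFun hij),
      ae_ne_of_indepFun (hXm i) (hCm j) (hXC.comp (measurable_pi_apply i) (measurable_pi_apply j)),
      ae_ne_of_indepFun (hXm j) (hCm i) (hXC.comp (measurable_pi_apply j) (measurable_pi_apply i)),
      ae_ne_of_indepFun (hCm i) (hCm j) (hCind.indepFun hij)] with ω h1 h2 h3 h4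
    exact ⟨h1, h2, h3, h4⟩
  have hall : ∀ᵐ ω ∂P, ∀ i j, i ≠ j → X i ω ≠ X j ω ∧ X i ω ≠ C j ω ∧ X j ω ≠ C i ω ∧
      C i ω ≠ C j ω := by
    refine ae_all_iff.mpr fun i => ae_all_iff.mpr fun j => ?_
    by_cases hij : i = j
    · exact Eventually.of_forall fun ω h => absurd hij h
    · filter_upwards [hpair i j hij] with ω hω _ using hω
  filter_upwards [hall] with ω hω i j hij
  by_contra hne
  obtain ⟨h1, h2, h3, h4⟩ := hω i j hne
  unfold obs at hij
  rcases min_choice (X i ω) (C i ω) with h | h <;> rcases min_choice (X j ω) (C j ω) with h' | h' <;>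
    rw [h, h'] at hij <;> simp_all

end Probability

/-! ### The endpoint and geometric levels below it -/

theorem rightEndpoint_eq {F : ℝ → ℝ} {τ : ℝ} (hτ : ∀ x, F x < 1 ↔ x < τ) :
    rightEndpoint F = (τ : EReal) := by
  unfold rightEndpoint
  refine le_antisymm (sSup_le ?_) (le_of_forall_lt fun y hy => ?_)
  · rintro _ ⟨x, hx, rfl⟩
    exact EReal.coe_le_coe_iff.mpr ((hτ x).mp hx).le
  · obtain ⟨z, hyz, hzτ⟩ := EReal.lt_iff_exists_real_btwn.mp hy
    exact hyz.trans_le (le_sSup ⟨z, (hτ z).mpr (EReal.coe_lt_coe_iff.mp hzτ), rfl⟩)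

/-- The points `τ - ζ^m (τ - s)`, approaching `τ` geometrically. -/
def geomLevel (τ ζ s : ℝ) (m : ℕ) : ℝ := τ - ζ ^ m * (τ - s)

theorem geomLevel_succ (τ ζ s : ℝ) (m : ℕ) :
    geomLevel τ ζ s (m + 1) = τ - ζ * (τ - geomLevel τ ζ s m) := by
  unfold geomLevel
  ring

theorem geomLevel_zero (τ ζ s : ℝ) : geomLevel τ ζ s 0 = s := by
  unfold geomLevel
  ring

theorem monotone_geomLevel {τ ζ s : ℝ} (h0 : 0 ≤ ζ) (h1 : ζ ≤ 1) (hs : s ≤ τ) :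
    Monotone (geomLevel τ ζ s) := by
  intro i j hij
  unfold geomLevel
  have := pow_le_pow_of_le_one h0 h1 hij
  nlinarith

theorem tendsto_geomLevel {τ ζ : ℝ} (h0 : 0 < ζ) (m : ℕ) :
    Tendsto (fun s => geomLevel τ ζ s m) (𝓝[<] τ) (𝓝[<] τ) := by
  refine tendsto_nhdsWithin_iff.mpr ⟨?_, ?_⟩
  · have h : Continuous fun s => geomLevel τ ζ s m := by
      unfold geomLevel
      fun_prop
    have h2 := h.tendsto τ
    have h3 : geomLevel τ ζ τ m = τ := by simp [geomLevel]
    rw [h3] at h2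
    exact h2.mono_left nhdsWithin_le_nhds
  · filter_upwards [self_mem_nhdsWithin] with s hs
    have hs : s < τ := hs
    have : 0 < ζ ^ m * (τ - s) := mul_pos (pow_pos h0 m) (by linarith)
    simp only [geomLevel, Set.mem_Iio]
    linarith

/-! ### The maximum term is negligible in probability -/

section Main

variable {Ω : Type*} [MeasurableSpace Ω] {P : Measure Ω}
  {X C : ℕ → Ω → ℝ} {F G H : ℝ → ℝ} {γX γC γ : ℝ} {k : ℕ → ℕ} {a : ℝ → ℝ}

/-- With probability tending to one the term of the maximum is below any fixed multiple of
`a_{n,k}^α`. -/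
theorem tendsto_measure_maxTerm_gt [IsProbabilityMeasure P]
    (hXm : ∀ i, Measurable (X i)) (hCm : ∀ i, Measurable (C i))
    (hX0 : ∀ᵐ ω ∂P, 0 ≤ X 0 ω)
    (hXid : ∀ i, IdentDistrib (X i) (X 0) P P) (hCid : ∀ i, IdentDistrib (C i) (C 0) P P)
    (hXind : iIndepFun X P) (hCind : iIndepFun C P)
    (hXC : IndepFun (fun ω i => X i ω) (fun ω i => C i ω) P)
    (hF : F = cdf (P.map (X 0))) (hG : G = cdf (P.map (C 0)))
    (hH : H = cdf (P.map (fun ω => min (X 0 ω) (C 0 ω))))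
    (hFcont : Continuous F) (hGcont : Continuous G)
    (hγX : γX < 0) (hγC : γC < 0) (hγ : γ < 0)
    (hFD : InDomainOfAttraction F γX) (hGD : InDomainOfAttraction G γC)
    (hend : rightEndpoint F = rightEndpoint G)
    (ha : IsLogAuxiliary (tailQuantile H) γ a)
    (hk : Tendsto k atTop atTop)
    (hkn : (fun n => (k n : ℝ)) =o[atTop] (fun n => (n : ℝ)))
    {α : ℝ} (hα : 1 ≤ α) {ε : ℝ} (hε : 0 < ε) :
    (∀ᶠ n : ℕ in atTop, 1 ≤ k n ∧ k n < n ∧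
      0 < a ((n : ℝ) / (k n : ℝ)) / tailQuantile H ((n : ℝ) / (k n : ℝ))) ∧
    Tendsto (fun n : ℕ => P {ω | ¬ |maxTerm α (fun i => X i ω) (fun i => C i ω) n (k n)| ≤
      ε * (a ((n : ℝ) / (k n : ℝ)) / tailQuantile H ((n : ℝ) / (k n : ℝ))) ^ α})
      atTop (𝓝 0) := by
  have hFmono : Monotone F := by rw [hF]; exact monotone_cdf _
  have hGmono : Monotone G := by rw [hG]; exact monotone_cdf _
  have hF1 : ∀ x, F x ≤ 1 := by rw [hF]; exact cdf_le_one _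
  have hG1 : ∀ x, G x ≤ 1 := by rw [hG]; exact cdf_le_one _
  obtain ⟨τ, hFτ, hFge, ζ, hζ0, hζ1, hFle⟩ := tail_le_and_ge_of_inDomainOfAttraction hγX hFmono
    hFcont (by rw [hF]; exact cdf_nonneg _) hF1 (by rw [hF]; exact tendsto_cdf_atBot _) hFD
  obtain ⟨τ', hGτ', hGge, -⟩ := tail_le_and_ge_of_inDomainOfAttraction hγC hGmono
    hGcont (by rw [hG]; exact cdf_nonneg _) hG1 (by rw [hG]; exact tendsto_cdf_atBot _) hGD
  have hττ : τ = τ' := by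
    rw [rightEndpoint_eq hFτ, rightEndpoint_eq hGτ'] at hend
    exact EReal.coe_injective hend
  subst hττ
  obtain ⟨cF, hcF, hFge⟩ := hFge ζ hζ0
  obtain ⟨cG, hcG, hGge⟩ := hGge ζ hζ0
  -- the distribution function of the observations
  have hFGH : ∀ s, 1 - H s = (1 - F s) * (1 - G s) := fun s => by
    rw [hF, hG, hH]
    exact one_sub_cdf_min hXm hCm hXid hCid hXC s
  have hHcont : Continuous H := by
    have : H = fun s => 1 - (1 - F s) * (1 - G s) := by
      ext s
      rw [← hFGH s]
      ring
    rw [this]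
    fun_prop
  have hHmono : Monotone H := by rw [hH]; exact monotone_cdf _
  have hHbot : Tendsto H atBot (𝓝 0) := by rw [hH]; exact tendsto_cdf_atBot _
  have hHtop : Tendsto H atTop (𝓝 1) := by rw [hH]; exact tendsto_cdf_atTop _
  have hHτ : ∀ x, H x < 1 ↔ x < τ := by
    intro x
    constructor
    · intro h
      by_contra! hx
      have h1 : F x = 1 := le_antisymm (hF1 x) (not_lt.mp fun h' => ((hFτ x).mp h').not_ge hx)
      have h2 := hFGH x
      rw [h1, sub_self, zero_mul] at h2
      linarith
    · intro h
      have h1 := (hFτ x).mpr h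
      have h2 := (hGτ' x).mpr h
      have h3 : 0 < (1 - F x) * (1 - G x) := mul_pos (by linarith) (by linarith)
      linarith [hFGH x]
  have hPF : ∀ s, P.real (X 0 ⁻¹' Set.Ioi s) = 1 - F s := fun s => by
    rw [hF, measureReal_preimage_Ioi (hXm 0)]
  have hPG : ∀ s, P.real (C 0 ⁻¹' Set.Ioi s) = 1 - G s := fun s => by
    rw [hG, measureReal_preimage_Ioi (hCm 0)]
  have hPF2 : ∀ {s t : ℝ}, s ≤ t → P.real (X 0 ⁻¹' Set.Ioc s t) = F t - F s := fun h => by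
    rw [hF, measureReal_preimage_Ioc (hXm 0) h]
  -- Non-negativity and continuity give `F 0 = 0 < 1`; positivity of `τ` is needed for the
  -- logarithms.
  have hτ0 : 0 < τ := by
    rw [← hFτ]
    have h1 : ∀ s < 0, F s = 0 := by
      intro s hs
      rw [hF, cdf_map_apply (hXm 0), measureReal_eq_zero_iff]
      refine measure_mono_null (fun ω hω => ?_) (ae_iff.mp hX0)
      have hω : X 0 ω ≤ s := hω
      exact not_le.mpr (hω.trans_lt hs)
    have h2 : F 0 = 0 := by
      refine tendsto_nhds_unique ((hFcont.tendsto 0).mono_left nhdsWithin_le_nhds : Tendsto F (𝓝[<] 0) _)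
        (tendsto_const_nhds.congr' ?_)
      filter_upwards [self_mem_nhdsWithin] with s hs
      exact (h1 s hs).symm
    rw [h2]
    exact one_pos
  -- almost sure properties
  have hinj := ae_injective_obs hXm hCm hXid hCid hXind hCind hXC (hF ▸ hFcont) (hG ▸ hGcont)
  have hle : ∀ᵐ ω ∂P, ∀ j, obs (fun i => X i ω) (fun i => C i ω) j ≤ τ := by
    refine ae_all_iff.mpr fun j => ?_
    have h1 : P.real (X 0 ⁻¹' Set.Ioi τ) = 0 := by
      rw [hPF, le_antisymm (hF1 τ) (not_lt.mp fun h' => lt_irrefl τ ((hFτ τ).mp h')), sub_self]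
    rw [measureReal_eq_zero_iff, ← (hXid j).measure_preimage_eq measurableSet_Ioi] at h1
    rw [ae_iff]
    refine measure_mono_null (fun ω hω => ?_) h1
    exact (not_le.mp hω).trans_le (min_le_left _ _)
  -- the levels
  have hk1 : ∀ᶠ n in atTop, 1 ≤ k n := hk.eventually_ge_atTop 1
  have ht : Tendsto (fun n : ℕ => (n : ℝ) / (k n : ℝ)) atTop atTop := by
    have h1 : Tendsto (fun n : ℕ => (k n : ℝ) / n) atTop (𝓝[>] 0) := by
      refine tendsto_nhdsWithin_iff.mpr ⟨hkn.tendsto_div_nhds_zero, ?_⟩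
      filter_upwards [hk1, eventually_ge_atTop 1] with n h1 h2
      have h1 : (1 : ℝ) ≤ k n := by exact_mod_cast h1
      have h2 : (1 : ℝ) ≤ n := by exact_mod_cast h2
      exact show (0 : ℝ) < (k n : ℝ) / n from div_pos (by linarith) (by linarith)
    exact h1.inv_tendsto_nhdsGT_zero.congr fun n => by simp
  have hkn' : ∀ᶠ n in atTop, k n < n := by
    filter_upwards [ht.eventually_gt_atTop 1, hk1] with n h1 h2
    have h2 : (1 : ℝ) ≤ k n := by exact_mod_cast h2
    rw [lt_div_iff₀ (by linarith), one_mul] at h1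
    exact_mod_cast h1
  have hU := tendsto_tailQuantile hHmono hHcont hHbot hHtop hHτ
  have hUval := fun {t : ℝ} => apply_tailQuantile hHmono hHcont hHbot hHtop (t := t)
  obtain ⟨hapos, hR⟩ := log_endpoint_sub_le hγ hτ0 (hU.mono_right nhdsWithin_le_nhds) ha
  obtain ⟨R, hR0, hR⟩ := hR (1 / 4) (by norm_num)
  refine ⟨hk1.and (hkn'.and (ht.eventually hapos)), ?_⟩
  -- The expected counts above `s₀` and `l` are `k/2` and `4k`. A relative error below one half
  -- leaves fewer than `3k/4` and more than `2k`, so with high probability `Z_{n-k,n}` exceeds `l`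
  -- and at most `k` observations exceed `s₀`.
  set s₀ : ℕ → ℝ := fun n => tailQuantile H ((n : ℝ) / (k n : ℝ) * 2) with hs₀
  set l : ℕ → ℝ := fun n => tailQuantile H ((n : ℝ) / (k n : ℝ) * (1 / 4)) with hl
  have ht2 : Tendsto (fun n : ℕ => (n : ℝ) / (k n : ℝ) * 2) atTop atTop :=
    ht.atTop_mul_const two_pos
  have ht4 : Tendsto (fun n : ℕ => (n : ℝ) / (k n : ℝ) * (1 / 4)) atTop atTop :=
    ht.atTop_mul_const (by norm_num)
  have hs₀τ : Tendsto s₀ atTop (𝓝[<] τ) := hU.comp ht2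
  have hlpos : ∀ᶠ n in atTop, 0 < l n :=
    ((hU.comp ht4).mono_right nhdsWithin_le_nhds).eventually (lt_mem_nhds hτ0)
  have hnH : ∀ {x : ℝ}, 0 < x → Tendsto (fun n : ℕ => (n : ℝ) / (k n : ℝ) * x) atTop atTop →
      ∀ᶠ n : ℕ in atTop, (n : ℝ) * (1 - H (tailQuantile H ((n : ℝ) / (k n : ℝ) * x))) =
        k n / x := by
    intro x hx htx
    filter_upwards [htx.eventually_gt_atTop 1, hk1, hkn'] with n h1 h2 h3
    rw [hUval h1, sub_sub_cancel]
    have h2 : (0 : ℝ) < k n := by exact_mod_cast h2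
    have h3 : (k n : ℝ) < n := by exact_mod_cast h3
    have h4 : (0 : ℝ) < n := h2.trans h3
    field_simp
  have hkR : Tendsto (fun n => (k n : ℝ)) atTop atTop := tendsto_natCast_atTop_atTop.comp hk
  set s : ℕ → ℕ → ℝ := fun n => geomLevel τ ζ (s₀ n) with hs
  have hsτ : ∀ m, Tendsto (fun n => s n m) atTop (𝓝[<] τ) := fun m =>
    (tendsto_geomLevel hζ0 m).comp hs₀τ
  have hmono : ∀ᶠ n in atTop, Monotone (s n) := by
    filter_upwards [hs₀τ.eventually self_mem_nhdsWithin] with n hn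
    exact monotone_geomLevel hζ0.le hζ1.le (le_of_lt hn)
  -- comparison of consecutive levels
  have hblock : ∀ m, ∀ᶠ n in atTop, cG / 2 * (1 - H (s n m)) ≤
      (F (s n (m + 1)) - F (s n m)) * (1 - G (s n (m + 1))) := by
    intro m
    filter_upwards [(hsτ m).eventually hFle, (hsτ m).eventually hGge] with n h1 h2
    simp only [hs] at h1 h2 ⊢
    rw [← geomLevel_succ] at h1 h2
    rw [hFGH]
    have h3 := hF1 (geomLevel τ ζ (s₀ n) m)
    -- The tail of `F` at least halves over the step, so half of its mass lies inside the block.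
    have h4 : (1 - F (geomLevel τ ζ (s₀ n) m)) / 2 ≤
      F (geomLevel τ ζ (s₀ n) (m + 1)) - F (geomLevel τ ζ (s₀ n) m) := by linarith
    have h5 := mul_le_mul h4 h2 (mul_nonneg hcG.le (by linarith [hG1 (geomLevel τ ζ (s₀ n) m)]))
      (by linarith)
    linarith
  have hstep : ∀ m, ∀ᶠ n in atTop, cF * cG * (1 - H (s n m)) ≤ 1 - H (s n (m + 1)) := by
    intro m
    filter_upwards [(hsτ m).eventually hFge, (hsτ m).eventually hGge] with n h1 h2
    simp only [hs] at h1 h2 ⊢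
    rw [← geomLevel_succ] at h1 h2
    rw [hFGH, hFGH]
    have h5 := mul_le_mul h1 h2 (mul_nonneg hcG.le (by linarith [hG1 (geomLevel τ ζ (s₀ n) m)]))
      (by linarith [hF1 (geomLevel τ ζ (s₀ n) (m + 1))])
    linarith
  have hnHtop : ∀ m, Tendsto (fun n : ℕ => (n : ℝ) * (1 - H (s n m))) atTop atTop := by
    intro m
    induction m with
    | zero =>
      refine (hkR.atTop_div_const two_pos).congr' ?_
      filter_upwards [hnH two_pos ht2] with n hn
      simp only [hs, geomLevel_zero]
      exact hn.symm
    | succ m ih =>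
      refine tendsto_atTop_mono' _ ?_ (ih.const_mul_atTop (mul_pos hcF hcG))
      filter_upwards [hstep m] with n hn
      have := mul_le_mul_of_nonneg_left hn (Nat.cast_nonneg (α := ℝ) n)
      linarith
  have hnptop : ∀ m, Tendsto (fun n : ℕ => (n : ℝ) * ((F (s n (m + 1)) - F (s n m)) *
      (1 - G (s n (m + 1))))) atTop atTop := by
    intro m
    refine tendsto_atTop_mono' _ ?_ ((hnHtop m).const_mul_atTop (half_pos hcG))
    filter_upwards [hblock m] with n hn
    have := mul_le_mul_of_nonneg_left hn (Nat.cast_nonneg (α := ℝ) n)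
    linarith
  -- the number of blocks
  obtain ⟨M, hM⟩ : ∃ M : ℕ, Real.exp (1 - M * (cG / 6)) * R ^ α ≤ ε := by
    have h1 : Tendsto (fun M : ℕ => 1 + -((M : ℝ) * (cG / 6))) atTop atBot :=
      tendsto_atBot_add_const_left _ _ (tendsto_neg_atTop_atBot.comp
        (tendsto_natCast_atTop_atTop.atTop_mul_const (by positivity)))
    have h2 := (Real.tendsto_exp_atBot.comp h1).mul_const (R ^ α)
    rw [zero_mul] at h2
    obtain ⟨M, hM⟩ := (h2.eventually (gt_mem_nhds hε)).exists
    refine ⟨M, le_of_lt ?_⟩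
    simpa [sub_eq_add_neg] using hM
  -- the exceptional events
  have hEl : Tendsto (fun n => P (deviationEvent P X C n (Set.Ioi (l n)) (Set.Ioi (l n)))) atTop
      (𝓝 0) := by
    refine tendsto_measure_deviationEvent hXm hCm hXid hCid hXind hCind hXC
      (fun n => measurableSet_Ioi) (fun n => measurableSet_Ioi) ?_
    refine (hkR.atTop_div_const (show (0 : ℝ) < 1 / 4 by norm_num)).congr' ?_
    filter_upwards [hnH (by norm_num) ht4] with n hn
    rw [hPF, hPG, ← hFGH]
    exact hn.symm
  have hEs : ∀ m, Tendsto (fun n => P (deviationEvent P X C n (Set.Ioi (s n m))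
      (Set.Ioi (s n m)))) atTop (𝓝 0) := by
    intro m
    refine tendsto_measure_deviationEvent hXm hCm hXid hCid hXind hCind hXC
      (fun n => measurableSet_Ioi) (fun n => measurableSet_Ioi) ?_
    refine (hnHtop m).congr fun n => ?_
    rw [hPF, hPG, ← hFGH]
  have hEb : ∀ m, Tendsto (fun n => P (deviationEvent P X C n (Set.Ioc (s n m) (s n (m + 1)))
      (Set.Ioi (s n (m + 1))))) atTop (𝓝 0) := by
    intro m
    refine tendsto_measure_deviationEvent hXm hCm hXid hCid hXind hCind hXC
      (fun n => measurableSet_Ioc) (fun n => measurableSet_Ioi) ?_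
    refine (hnptop m).congr' ?_
    filter_upwards [hmono] with n hn
    rw [hPF2 (hn (Nat.le_succ m)), hPG]
  have hsum : Tendsto (fun n =>
      P (deviationEvent P X C n (Set.Ioi (l n)) (Set.Ioi (l n))) +
        ∑ m ∈ Finset.range (M + 1), (P (deviationEvent P X C n (Set.Ioi (s n m)) (Set.Ioi (s n m))) +
          P (deviationEvent P X C n (Set.Ioc (s n m) (s n (m + 1))) (Set.Ioi (s n (m + 1))))))
      atTop (𝓝 0) := by
    have := hEl.add (tendsto_finsetSum (Finset.range (M + 1)) fun m _ => (hEs m).add (hEb m))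
    simpa using this
  refine tendsto_of_tendsto_of_tendsto_of_le_of_le' tendsto_const_nhds hsum
    (Eventually.of_forall fun _ => zero_le) ?_
  -- The range `M + 1` ensures that level 0 is controlled even when `M = 0`.
  have hblock' : ∀ᶠ n in atTop, ∀ m ∈ Finset.range (M + 1), cG / 2 * (1 - H (s n m)) ≤
      (F (s n (m + 1)) - F (s n m)) * (1 - G (s n (m + 1))) :=
    (eventually_all_finset _).mpr fun m _ => hblock m
  have hpos' : ∀ᶠ n : ℕ in atTop, ∀ m ∈ Finset.range (M + 1), 0 < (n : ℝ) * (1 - H (s n m)) :=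
    (eventually_all_finset _).mpr fun m _ => (hnHtop m).eventually_gt_atTop 0
  filter_upwards [hblock', hpos', hmono, hk1, hkn', hnH two_pos ht2, hnH (by norm_num) ht4, hlpos,
    ht.eventually hR, ht.eventually hapos, (hkR.eventually_gt_atTop 0)]
    with n hbl hps hmn hk1 hkn hH2 hH4 hlp hRn hapn hk0
  have hN0 : P {ω | ¬ (Function.Injective (obs (fun i => X i ω) (fun i => C i ω)) ∧
      ∀ j, obs (fun i => X i ω) (fun i => C i ω) j ≤ τ)} = 0 := ae_iff.mp (hinj.and hle)
  refine le_trans (measure_mono (t :=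
    {ω | ¬ (Function.Injective (obs (fun i => X i ω) (fun i => C i ω)) ∧
      ∀ j, obs (fun i => X i ω) (fun i => C i ω) j ≤ τ)} ∪
    (deviationEvent P X C n (Set.Ioi (l n)) (Set.Ioi (l n)) ∪
      ⋃ m ∈ Finset.range (M + 1), (deviationEvent P X C n (Set.Ioi (s n m)) (Set.Ioi (s n m)) ∪
        deviationEvent P X C n (Set.Ioc (s n m) (s n (m + 1))) (Set.Ioi (s n (m + 1)))))) ?_) ?_
  · intro ω
    contrapose
    intro hω
    simp only [Set.mem_union, Set.mem_iUnion, not_or, not_exists, Set.mem_ofPred_eq, not_not] at hω ⊢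
    obtain ⟨⟨hωinj, hωle⟩, hωl, hωs⟩ := hω
    simp only [deviationEvent, Set.mem_ofPred_eq, not_le, sum_indicator_Ioi, sum_indicator_block,
      hPF, hPG, ← hFGH] at hωl hωs
    have hdev : ∀ m ∈ Finset.range (M + 1), 0 < (numAbove (X · ω) (C · ω) n (s n m) : ℝ) ∧
        (numAbove (X · ω) (C · ω) n (s n m) : ℝ) ≤ 3 / 2 * (n * (1 - H (s n m))) ∧
        cG / 4 * (n * (1 - H (s n m))) ≤
          (numBlock (X · ω) (C · ω) n (s n m) (s n (m + 1)) : ℝ) := by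
      intro m hm
      obtain ⟨h1, h2⟩ := hωs m hm
      have h3 := hps m hm
      rw [hPF2 (hmn (Nat.le_succ m))] at h2
      rw [abs_lt] at h1 h2
      have h4 := mul_le_mul_of_nonneg_left (hbl m hm) (Nat.cast_nonneg (α := ℝ) n)
      exact ⟨by linarith, by linarith, by linarith⟩
    have hNs : numAbove (X · ω) (C · ω) n (s n 0) ≤ k n := by
      have h1 := (hdev 0 (by simp)).2.1
      simp only [hs, geomLevel_zero] at h1
      have h2 : (n : ℝ) * (1 - H (s₀ n)) = k n / 2 := hH2
      rw [h2] at h1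
      have h3 : (numAbove (X · ω) (C · ω) n (s n 0) : ℝ) ≤ k n := by
        simp only [hs, geomLevel_zero]
        linarith
      exact_mod_cast h3
    have hNl : k n < numAbove (X · ω) (C · ω) n (l n) := by
      have h2 : (n : ℝ) * (1 - H (l n)) = k n / (1 / 4) := hH4
      rw [h2, abs_lt] at hωl
      have h3 : (k n : ℝ) < numAbove (X · ω) (C · ω) n (l n) := by linarith [hωl.1]
      exact_mod_cast h3
    -- `cG / 6` is the ratio of `cG / 4` (half the expected block proportion `cG / 2`) to `3 / 2`
    -- (the upper deviation of the count above the level).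
    have hmax := abs_maxTerm_le (α := α) (by linarith) hk1 hkn hωinj.injOn hmn M hNs
      (κ := cG / 6)
      (fun m hm => by
        obtain ⟨h1, h2, h3⟩ := hdev m (Finset.mem_range.mpr (by omega))
        rw [le_div_iff₀ h1]
        calc cG / 6 * (numAbove (X · ω) (C · ω) n (s n m) : ℝ)
            ≤ cG / 6 * (3 / 2 * (n * (1 - H (s n m)))) := by gcongr
          _ = cG / 4 * (n * (1 - H (s n m))) := by ring
          _ ≤ _ := h3) hlp hNl hωle
    have hlog : 0 ≤ Real.log τ - Real.log (l n) := by
      have h1 := lt_obsOrd_of_lt_numAbove hNl hkn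
      linarith [Real.log_le_log hlp (h1.le.trans (hωle _))]
    calc _ ≤ _ := hmax
      _ ≤ Real.exp (1 - M * (cG / 6)) *
          (R * (a ((n : ℝ) / (k n : ℝ)) / tailQuantile H ((n : ℝ) / (k n : ℝ)))) ^ α := by
          gcongr
      _ = Real.exp (1 - M * (cG / 6)) * R ^ α *
          (a ((n : ℝ) / (k n : ℝ)) / tailQuantile H ((n : ℝ) / (k n : ℝ))) ^ α := by
          rw [Real.mul_rpow hR0 hapn.le, mul_assoc]
      _ ≤ _ := by gcongr
  · refine (measure_union_le _ _).trans ?_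
    rw [hN0, zero_add]
    refine (measure_union_le _ _).trans (add_le_add le_rfl ?_)
    refine (measure_biUnion_finset_le _ _).trans (Finset.sum_le_sum fun m _ => ?_)
    exact measure_union_le _ _

/-- Convergence in measure to zero from bounds off exceptional sets. -/
theorem tendstoInMeasure_zero_of_abs_le {D g : ℕ → Ω → ℝ} {w : ℕ → ℝ}
    (hw : ∀ᶠ n in atTop, 0 < w n) (hg : ∀ᶠ n in atTop, ∀ᵐ ω ∂P, |g n ω| ≤ |D n ω|)
    (hD : ∀ ε : ℝ, 0 < ε → Tendsto (fun n => P {ω | ¬ |D n ω| ≤ ε * w n}) atTop (𝓝 0)) :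
    TendstoInMeasure P (fun n ω => g n ω / w n) atTop fun _ => 0 := by
  refine tendstoInMeasure_of_ne_top fun ε hε hεtop => ?_
  set e := ε.toReal with he
  have hepos : 0 < e := ENNReal.toReal_pos hε.ne' hεtop
  -- Half of `e` is used because convergence in measure concerns the event `≥ e`, while the given
  -- bound is a weak inequality as well.
  refine tendsto_of_tendsto_of_tendsto_of_le_of_le' tendsto_const_nhds (hD (e / 2) (half_pos hepos))
    (Eventually.of_forall fun _ => zero_le) ?_
  filter_upwards [hw, hg] with n hwn hgn
  refine measure_mono_ae ?_
  filter_upwards [hgn] with ω hω h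
  have h : ε ≤ edist (g n ω / w n) 0 := h
  change ¬ |D n ω| ≤ e / 2 * w n
  intro hcon
  rw [edist_dist, dist_zero_right, Real.norm_eq_abs, abs_div, abs_of_pos hwn,
    ← ENNReal.ofReal_toReal hεtop, ENNReal.ofReal_le_ofReal_iff (by positivity),
    le_div_iff₀ hwn] at h
  have : 0 < e * w n := mul_pos hepos hwn
  linarith

end Main

end CensoredEVT

end

theorem proposition1
    {Ω : Type*} [MeasurableSpace Ω] (P : Measure Ω) [IsProbabilityMeasure P]
    -- two independent i.i.d. non-negative samples with continuous distribution functions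
    (X C : ℕ → Ω → ℝ)
    (hXm : ∀ i, Measurable (X i)) (hCm : ∀ i, Measurable (C i))
    (hXnn : ∀ i, ∀ᵐ ω ∂P, 0 ≤ X i ω) (hCnn : ∀ i, ∀ᵐ ω ∂P, 0 ≤ C i ω)
    (hXid : ∀ i, IdentDistrib (X i) (X 0) P P) (hCid : ∀ i, IdentDistrib (C i) (C 0) P P)
    (hXind : iIndepFun X P) (hCind : iIndepFun C P)
    (hXC : IndepFun (fun ω i => X i ω) (fun ω i => C i ω) P)
    (F G H : ℝ → ℝ)
    (hF : F = cdf (P.map (X 0))) (hG : G = cdf (P.map (C 0)))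
    (hH : H = cdf (P.map (fun ω => min (X 0 ω) (C 0 ω))))
    (hFcont : Continuous F) (hGcont : Continuous G) :
    -- (i): the identity holds whenever there are no ties, and almost surely there are none
    ((∀ᵐ ω ∂P, Function.Injective (CensoredEVT.obs (fun i => X i ω) (fun i => C i ω))) ∧
      ∀ (ω : Ω) (n k : ℕ) (α : ℝ), 1 ≤ α → 1 ≤ k → k < n →
        Set.InjOn (CensoredEVT.obs (fun i => X i ω) (fun i => C i ω)) (Set.Iio n) →
        CensoredEVT.momentL α (fun i => X i ω) (fun i => C i ω) n k =
          CensoredEVT.momentKM α (fun i => X i ω) (fun i => C i ω) n k +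
            (1 - (CensoredEVT.uncOrd (fun i => X i ω) (fun i => C i ω) n n : ℝ)) *
              CensoredEVT.maxTerm α (fun i => X i ω) (fun i => C i ω) n k) ∧
    -- (ii): `D = o_P(a_{n,k}^α)`, hence the two moments differ by `o_P(a_{n,k}^α)`
    (∀ (γX γC γ : ℝ) (k : ℕ → ℕ) (a : ℝ → ℝ),
      γX < 0 → γC < 0 → γ = γX * γC / (γX + γC) →
      CensoredEVT.InDomainOfAttraction F γX → CensoredEVT.InDomainOfAttraction G γC →
      CensoredEVT.rightEndpoint F = CensoredEVT.rightEndpoint G →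
      CensoredEVT.IsLogAuxiliary (CensoredEVT.tailQuantile H) γ a →
      Tendsto k atTop atTop →
      (fun n => (k n : ℝ)) =o[atTop] (fun n => (n : ℝ)) →
      CensoredEVT.GrowthCondition γX γC k →
      ∀ α : ℝ, 1 ≤ α →
        TendstoInMeasure P
          (fun n ω =>
            CensoredEVT.maxTerm α (fun i => X i ω) (fun i => C i ω) n (k n) /
              (a ((n : ℝ) / (k n : ℝ)) /
                CensoredEVT.tailQuantile H ((n : ℝ) / (k n : ℝ))) ^ α)
          atTop (fun _ => 0) ∧
        TendstoInMeasure P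
          (fun n ω =>
            (CensoredEVT.momentL α (fun i => X i ω) (fun i => C i ω) n (k n) -
                CensoredEVT.momentKM α (fun i => X i ω) (fun i => C i ω) n (k n)) /
              (a ((n : ℝ) / (k n : ℝ)) /
                CensoredEVT.tailQuantile H ((n : ℝ) / (k n : ℝ))) ^ α)
          atTop (fun _ => 0)) := by
  subst hF hG
  have hinj := CensoredEVT.ae_injective_obs hXm hCm hXid hCid hXind hCind hXC hFcont hGcont
  refine ⟨⟨hinj, fun ω n k α hα hk hkn h => CensoredEVT.momentL_eq hα hk hkn h⟩, ?_⟩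
  intro γX γC γ k a hγX hγC hγ hFD hGD hend ha hk hkn _ α hα
  have hγ0 : γ < 0 := by
    rw [hγ]
    exact div_neg_of_pos_of_neg (mul_pos_of_neg_of_neg hγX hγC) (by linarith)
  have hmain := fun {ε : ℝ} => CensoredEVT.tendsto_measure_maxTerm_gt hXm hCm (hXnn 0) hXid hCid
    hXind hCind hXC rfl rfl hH hFcont hGcont hγX hγC hγ0 hFD hGD hend ha hk hkn hα (ε := ε)
  have hev := (hmain one_pos).1
  have hw := hev.mono fun n hn => Real.rpow_pos_of_pos hn.2.2 α
  refine ⟨CensoredEVT.tendstoInMeasure_zero_of_abs_le hw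
      (Eventually.of_forall fun n => Eventually.of_forall fun ω => le_rfl)
      fun ε hε => (hmain hε).2,
    CensoredEVT.tendstoInMeasure_zero_of_abs_le hw ?_ fun ε hε => (hmain hε).2⟩
  filter_upwards [hev] with n hn
  filter_upwards [hinj] with ω hω
  rw [CensoredEVT.momentL_eq hα hn.1 hn.2.1 hω.injOn, add_sub_cancel_left, abs_mul]
  -- The difference of the moments is the maximum term times `1 - δ_{n,n}`, which is 0 or 1.
  refine mul_le_of_le_one_left (abs_nonneg _) ?_
  rcases CensoredEVT.uncOrd_eq_zero_or_one (x := fun i => X i ω) (c := fun i => C i ω) (n := n) n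
    with h | h <;> simp [h]
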